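/- Let $\lambda\in\mathbb C$, $\lambda\neq 0$, and let $\mathbb R^3_\lambda\cong U(\mathfrak{su}(2))$ be the unital associative $\mathbb C$-algebra generated by $x_+,x_-,h$ with relations $$[h,x_\pm]=\pm 2\lambda x_\pm,\qquad [x_+,x_-]=\lambda h,$$ with coproduct $\Delta\xi=\xi\otimes 1+1\otimes\xi$ and counit $\epsilon(\xi)=0$ on the generators $\xi\in\{x_+,x_-,h\}$. Given a representation $\rho:\mathbb R^3_\lambda\to\mathrm{End}(V)$ and a vector $\Lambda\in V$, the associated differential calculus is as follows. The $n$-forms are $\Omega^n=\bigwedge^n V\otimes\mathbb R^3_\lambda$ (where $\omega\otimes f$ is written $\omega f$, and $\bigwedge^n V$ is the $n$-th exterior power of $V$), with commutation relations $\xi v=v\xi+\rho(\xi)v$ between generators $\xi$ and elements $v\in V$. The exterior derivative is $$\mathrm d f=\lambda^{-1}\sum\rho\big(f_{(1)}-\epsilon(f_{(1)})1\big)\Lambda\; f_{(2)},\qquad \mathrm d(\omega f)=\omega\wedge \mathrm d f\qquad(f\in\mathbb R^3_\lambda,\ \omega\in\bigwedge^n V);$$ it satisfies $\mathrm d^2=0$.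 Let $H^n$ be its $n$-th cohomology (closed $n$-forms modulo exact $n$-forms). (a) Let $V=\mathbb C^3$ with basis $e_+,e_0,e_-$, let $$\rho(x_+)=\lambda\begin{pmatrix}0&2&0\\0&0&1\\0&0&0\end{pmatrix},\quad \rho(x_-)=\lambda\begin{pmatrix}0&0&0\\1&0&0\\0&2&0\end{pmatrix},\quad \rho(h)=\lambda\begin{pmatrix}2&0&0\\0&0&0\\0&0&-2\end{pmatrix}$$ and $\Lambda=e_0$. Then $$H^0=\mathbb C[h],\qquad H^1=e_0\,\mathbb C[h],\qquad H^2=H^3=\{0\}.$$ That is, for every polynomial $p$ the function $p(h)$ and the $1$-form $e_0\,p(h)$ are closed, and $p\mapsto [p(h)]$ and $p\mapsto[e_0\,p(h)]$ are linear isomorphisms from the polynomial ring $\mathbb C[X]$ onto $H^0$ and $H^1$ respectively. (b) Let $V=\mathbb C^2$ with basis $e_1,e_2$, let $$\rho(x_+)=\lambda\begin{pmatrix}0&1\\0&0\end{pmatrix},\quad \rho(x_-)=\lambda\begin{pmatrix}0&0\\1&0\end{pmatrix},\quad \rho(h)=\lambda\begin{pmatrix}1&0\\0&-1\end{pmatrix}$$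 and $\Lambda=e_1$. Then $$H^0=\mathbb C[x_+],\qquad H^1=H^2=\{0\}.$$ That is, for every polynomial $p$ the function $p(x_+)$ is closed, and $p\mapsto[p(x_+)]$ is a linear isomorphism from $\mathbb C[X]$ onto $H^0$. -/

import Mathlib

open scoped TensorProduct

noncomputable section

namespace R3Calculus

/-! ### The algebra generated by `x₊, x₋, h` -/

/-- The three generators. -/
inductive Gen : Type
  | xp : Gen
  | xm : Gen
  | h : Gen

/-- The relations `[h, x₊] = 2 lam x₊`, `[h, x₋] = -2 lam x₋`, `[x₊, x₋] = lam h`. -/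
inductive Rel (lam : ℂ) : FreeAlgebra ℂ Gen → FreeAlgebra ℂ Gen → Prop
  | h_xp : Rel lam
      (FreeAlgebra.ι ℂ Gen.h * FreeAlgebra.ι ℂ Gen.xp)
      (FreeAlgebra.ι ℂ Gen.xp * FreeAlgebra.ι ℂ Gen.h + (2 * lam) • FreeAlgebra.ι ℂ Gen.xp)
  | h_xm : Rel lam
      (FreeAlgebra.ι ℂ Gen.h * FreeAlgebra.ι ℂ Gen.xm)
      (FreeAlgebra.ι ℂ Gen.xm * FreeAlgebra.ι ℂ Gen.h - (2 * lam) • FreeAlgebra.ι ℂ Gen.xm)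
  | xp_xm : Rel lam
      (FreeAlgebra.ι ℂ Gen.xp * FreeAlgebra.ι ℂ Gen.xm)
      (FreeAlgebra.ι ℂ Gen.xm * FreeAlgebra.ι ℂ Gen.xp + lam • FreeAlgebra.ι ℂ Gen.h)

/-- The algebra `ℝ³_lam`: the unital associative complex algebra presented by `x₊, x₋, h` and
the relations above. -/
def R3 (lam : ℂ) : Type := RingQuot (Rel lam)

instance (lam : ℂ) : Ring (R3 lam) := inferInstanceAs (Ring (RingQuot (Rel lam)))

instance (lam : ℂ) : Algebra ℂ (R3 lam) := inferInstanceAs (Algebra ℂ (RingQuot (Rel lam)))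

/-- The generators as elements of the algebra. -/
def gen (lam : ℂ) (g : Gen) : R3 lam := RingQuot.mkAlgHom ℂ (Rel lam) (FreeAlgebra.ι ℂ g)

theorem gen_h_xp (lam : ℂ) : gen lam Gen.h * gen lam Gen.xp =
    gen lam Gen.xp * gen lam Gen.h + (2 * lam) • gen lam Gen.xp := by
  have := RingQuot.mkAlgHom_rel ℂ (Rel.h_xp (lam := lam))
  simp only [map_mul, map_add, map_smul] at this
  exact this

theorem gen_h_xm (lam : ℂ) : gen lam Gen.h * gen lam Gen.xm =
    gen lam Gen.xm * gen lam Gen.h - (2 * lam) • gen lam Gen.xm := by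
  have := RingQuot.mkAlgHom_rel ℂ (Rel.h_xm (lam := lam))
  simp only [map_mul, map_sub, map_smul] at this
  exact this

theorem gen_xp_xm (lam : ℂ) : gen lam Gen.xp * gen lam Gen.xm =
    gen lam Gen.xm * gen lam Gen.xp + lam • gen lam Gen.h := by
  have := RingQuot.mkAlgHom_rel ℂ (Rel.xp_xm (lam := lam))
  simp only [map_mul, map_add, map_smul] at this
  exact this

/-- Universal property: an algebra map out of `R3 lam` from images of the generators that
satisfy the three commutation relations. -/
def lift (lam : ℂ) {B : Type*} [Ring B] [Algebra ℂ B] (f : Gen → B)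
    (h1 : f Gen.h * f Gen.xp = f Gen.xp * f Gen.h + (2 * lam) • f Gen.xp)
    (h2 : f Gen.h * f Gen.xm = f Gen.xm * f Gen.h - (2 * lam) • f Gen.xm)
    (h3 : f Gen.xp * f Gen.xm = f Gen.xm * f Gen.xp + lam • f Gen.h) : R3 lam →ₐ[ℂ] B :=
  RingQuot.liftAlgHom ℂ ⟨FreeAlgebra.lift ℂ f, by
    intro x y hxy
    cases hxy with
    | h_xp => simpa only [map_mul, map_add, map_smul, FreeAlgebra.lift_ι_apply] using h1
    | h_xm => simpa only [map_mul, map_sub, map_smul, FreeAlgebra.lift_ι_apply] using h2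
    | xp_xm => simpa only [map_mul, map_add, map_smul, FreeAlgebra.lift_ι_apply] using h3⟩

theorem lift_gen (lam : ℂ) {B : Type*} [Ring B] [Algebra ℂ B] (f : Gen → B)
    (h1 : f Gen.h * f Gen.xp = f Gen.xp * f Gen.h + (2 * lam) • f Gen.xp)
    (h2 : f Gen.h * f Gen.xm = f Gen.xm * f Gen.h - (2 * lam) • f Gen.xm)
    (h3 : f Gen.xp * f Gen.xm = f Gen.xm * f Gen.xp + lam • f Gen.h) (g : Gen) :
    lift lam f h1 h2 h3 (gen lam g) = f g := by
  unfold lift gen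
  refine (RingQuot.liftAlgHom_mkAlgHom_apply _ _ _ _).trans ?_
  exact FreeAlgebra.lift_ι_apply _ _

theorem algHom_ext (lam : ℂ) {B : Type*} [Ring B] [Algebra ℂ B] (f f' : R3 lam →ₐ[ℂ] B)
    (hff : ∀ g, f (gen lam g) = f' (gen lam g)) : f = f' := by
  refine RingQuot.ringQuot_ext' ℂ f f' (FreeAlgebra.hom_ext ?_)
  funext g
  exact hff g

/-! ### The additive coproduct -/

/-- `Δ ξ = ξ ⊗ 1 + 1 ⊗ ξ` on generators. -/
def comulHom (lam : ℂ) : R3 lam →ₐ[ℂ] R3 lam ⊗[ℂ] R3 lam :=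
  lift lam (fun g => gen lam g ⊗ₜ[ℂ] 1 + 1 ⊗ₜ[ℂ] gen lam g)
    (by
      simp only [add_mul, mul_add, Algebra.TensorProduct.tmul_mul_tmul, one_mul, mul_one,
        gen_h_xp, TensorProduct.add_tmul, TensorProduct.tmul_add, smul_add,
        TensorProduct.smul_tmul', TensorProduct.tmul_smul]
      abel)
    (by
      simp only [add_mul, mul_add, Algebra.TensorProduct.tmul_mul_tmul, one_mul, mul_one,
        gen_h_xm, TensorProduct.sub_tmul, TensorProduct.tmul_sub, smul_add,
        TensorProduct.smul_tmul', TensorProduct.tmul_smul]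
      abel)
    (by
      simp only [add_mul, mul_add, Algebra.TensorProduct.tmul_mul_tmul, one_mul, mul_one,
        gen_xp_xm, TensorProduct.add_tmul, TensorProduct.tmul_add, smul_add,
        TensorProduct.smul_tmul', TensorProduct.tmul_smul]
      abel)

/-- `ε ξ = 0` on generators. -/
def counitHom (lam : ℂ) : R3 lam →ₐ[ℂ] ℂ :=
  lift lam (fun _ => 0) (by simp) (by simp) (by simp)

theorem comulHom_gen (lam : ℂ) (g : Gen) :
    comulHom lam (gen lam g) = gen lam g ⊗ₜ[ℂ] 1 + 1 ⊗ₜ[ℂ] gen lam g :=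
  lift_gen lam _ _ _ _ g

theorem counitHom_gen (lam : ℂ) (g : Gen) : counitHom lam (gen lam g) = 0 :=
  lift_gen lam _ _ _ _ g

instance (lam : ℂ) : Bialgebra ℂ (R3 lam) :=
  Bialgebra.ofAlgHom (comulHom lam) (counitHom lam)
    (algHom_ext lam _ _ fun g => by
      simp [comulHom_gen, TensorProduct.add_tmul, TensorProduct.tmul_add,
        Algebra.TensorProduct.one_def, add_assoc])
    (algHom_ext lam _ _ fun g => by
      simp [comulHom_gen, counitHom_gen])
    (algHom_ext lam _ _ fun g => by
      simp [comulHom_gen, counitHom_gen])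

theorem comul_eq (lam : ℂ) (f : R3 lam) : Coalgebra.comul (R := ℂ) f = comulHom lam f := rfl

/-! ### The calculus attached to a representation `ρ` on `V` and a vector `L` of `V`

Invariant 1-forms are the elements of `V`; the space of 1-forms is `V ⊗ R3 lam`, where `v ⊗ f`
stands for `v f`. -/

section Calculus

variable {lam : ℂ} {V : Type*} [AddCommGroup V] [Module ℂ V]

/-- The map `a ↦ ρ(a - ε(a) 1) L`. -/
def proj (ρ : R3 lam →ₐ[ℂ] Module.End ℂ V) (L : V) : R3 lam →ₗ[ℂ] V where
  toFun a := ρ (a - algebraMap ℂ (R3 lam) (Coalgebra.counit (R := ℂ) a)) L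
  map_add' a b := by
    simp only [map_add, map_sub, LinearMap.sub_apply, LinearMap.add_apply]; abel
  map_smul' c a := by
    have h : algebraMap ℂ (R3 lam) (Coalgebra.counit (R := ℂ) (c • a)) =
        c • algebraMap ℂ (R3 lam) (Coalgebra.counit (R := ℂ) a) := by
      simp [Algebra.smul_def]
    rw [h, ← smul_sub, map_smul]
    rfl

/-- The differential on functions: `d f = lam⁻¹ ∑ ρ(f₍₁₎ - ε(f₍₁₎) 1) L ⊗ f₍₂₎`. -/
def d0 (ρ : R3 lam →ₐ[ℂ] Module.End ℂ V) (L : V) : R3 lam →ₗ[ℂ] V ⊗[ℂ] R3 lam :=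
  lam⁻¹ • (TensorProduct.map (proj ρ L) LinearMap.id ∘ₗ Coalgebra.comul)

/-- The left action of functions on 1-forms: `a (v ⊗ f) = ∑ ρ(a₍₁₎) v ⊗ a₍₂₎ f`. -/
def leftMul (ρ : R3 lam →ₐ[ℂ] Module.End ℂ V) :
    R3 lam →ₐ[ℂ] Module.End ℂ (V ⊗[ℂ] R3 lam) :=
  (Module.endTensorEndAlgHom (R := ℂ) (S := ℂ) (A := ℂ) (M := V) (N := R3 lam)).comp
    ((Algebra.TensorProduct.map ρ (Algebra.lmul ℂ (R3 lam))).comp (comulHom lam))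

/-- The right action of functions on 1-forms: `(v ⊗ f) a = v ⊗ f a`. -/
def rightMul (V : Type*) [AddCommGroup V] [Module ℂ V] (a : R3 lam) :
    Module.End ℂ (V ⊗[ℂ] R3 lam) :=
  LinearMap.lTensor V (LinearMap.mulRight ℂ a)

/-- The commutation relations `ξ v = v ξ + ρ(ξ) v` for a generator `ξ` and `v ∈ V`. -/
theorem leftMul_gen (ρ : R3 lam →ₐ[ℂ] Module.End ℂ V) (g : Gen) (v : V) :
    leftMul ρ (gen lam g) (v ⊗ₜ 1) =
      rightMul V (gen lam g) (v ⊗ₜ 1) + ρ (gen lam g) v ⊗ₜ 1 := by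
  rw [leftMul, AlgHom.comp_apply, AlgHom.comp_apply, comulHom_gen, map_add, map_add,
    Algebra.TensorProduct.map_tmul, Algebra.TensorProduct.map_tmul, LinearMap.add_apply,
    Module.endTensorEndAlgHom_apply, Module.endTensorEndAlgHom_apply]
  simp [rightMul, add_comm]

theorem d0_eq (ρ : R3 lam →ₐ[ℂ] Module.End ℂ V) (L : V) (f : R3 lam) :
    d0 ρ L f = lam⁻¹ • (leftMul ρ f (L ⊗ₜ 1) - L ⊗ₜ f) := by
  have h2 : TensorProduct.map (LinearMap.toSpanSingleton ℂ V L ∘ₗ Coalgebra.counit)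
      (LinearMap.id : R3 lam →ₗ[ℂ] R3 lam) (Coalgebra.comul (R := ℂ) f) = L ⊗ₜ[ℂ] f := by
    have h3 := Coalgebra.rTensor_counit_comul (R := ℂ) f
    have h4 := congrArg (LinearMap.rTensor (R3 lam) (LinearMap.toSpanSingleton ℂ V L)) h3
    rw [← LinearMap.comp_apply, ← LinearMap.rTensor_comp] at h4
    simpa [LinearMap.rTensor] using h4
  have h1 : ∀ t : R3 lam ⊗[ℂ] R3 lam, TensorProduct.map (proj ρ L) LinearMap.id t =
      (Module.endTensorEndAlgHom (R := ℂ) (S := ℂ) (A := ℂ) (M := V) (N := R3 lam))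
        (Algebra.TensorProduct.map ρ (Algebra.lmul ℂ (R3 lam)) t) (L ⊗ₜ 1) -
      TensorProduct.map (LinearMap.toSpanSingleton ℂ V L ∘ₗ Coalgebra.counit)
        (LinearMap.id : R3 lam →ₗ[ℂ] R3 lam) t := by
    intro t
    induction t with
    | zero => simp
    | add a b ha hb => simp only [map_add, LinearMap.add_apply, ha, hb]; abel
    | tmul a b =>
      rw [Algebra.TensorProduct.map_tmul, Module.endTensorEndAlgHom_apply]
      simp [proj, TensorProduct.sub_tmul, Algebra.algebraMap_eq_smul_one]
  rw [d0, LinearMap.smul_apply, LinearMap.comp_apply, h1, h2]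
  rfl

/-- The Leibniz rule `d(f g) = (d f) g + f (d g)`. -/
theorem d0_mul (ρ : R3 lam →ₐ[ℂ] Module.End ℂ V) (L : V) (f g : R3 lam) :
    d0 ρ L (f * g) = rightMul V g (d0 ρ L f) + leftMul ρ f (d0 ρ L g) := by
  have hcomm : ∀ w : V ⊗[ℂ] R3 lam,
      leftMul ρ f (rightMul V g w) = rightMul V g (leftMul ρ f w) := by
    intro w
    have : ∀ t : R3 lam ⊗[ℂ] R3 lam,
        (Module.endTensorEndAlgHom (R := ℂ) (S := ℂ) (A := ℂ) (M := V) (N := R3 lam))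
          (Algebra.TensorProduct.map ρ (Algebra.lmul ℂ (R3 lam)) t) (rightMul V g w) =
        rightMul V g ((Module.endTensorEndAlgHom (R := ℂ) (S := ℂ) (A := ℂ) (M := V)
          (N := R3 lam)) (Algebra.TensorProduct.map ρ (Algebra.lmul ℂ (R3 lam)) t) w) := by
      intro t
      induction t with
      | zero => simp
      | add a b ha hb => simp only [map_add, LinearMap.add_apply, ha, hb]
      | tmul a b =>
        rw [Algebra.TensorProduct.map_tmul, Module.endTensorEndAlgHom_apply]
        induction w with
        | zero => simp
        | add u v hu hv => simp only [map_add, hu, hv]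
        | tmul v c => simp [rightMul, mul_assoc]
    exact this _
  have hg : (L ⊗ₜ[ℂ] g : V ⊗[ℂ] R3 lam) = rightMul V g (L ⊗ₜ 1) := by simp [rightMul]
  have hfg : (L ⊗ₜ[ℂ] (f * g) : V ⊗[ℂ] R3 lam) = rightMul V g (L ⊗ₜ f) := by simp [rightMul]
  rw [d0_eq, d0_eq, d0_eq, hfg, hg, map_mul, Module.End.mul_apply]
  simp only [map_smul, map_sub, hcomm, smul_sub]
  abel

/-- Right multiplication `ω ⊗ v ↦ ω ∧ v` in the exterior algebra of `V`. -/
def wedge (V : Type*) [AddCommGroup V] [Module ℂ V] (n : ℕ) :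
    (⋀[ℂ]^n V) ⊗[ℂ] V →ₗ[ℂ] ⋀[ℂ]^(n + 1) V :=
  TensorProduct.lift <| LinearMap.mk₂ ℂ
    (fun ω v => ⟨(ω : ExteriorAlgebra ℂ V) * ExteriorAlgebra.ι ℂ v, by
      have h : (ω : ExteriorAlgebra ℂ V) * ExteriorAlgebra.ι ℂ v ∈
          (LinearMap.range (ExteriorAlgebra.ι ℂ : V →ₗ[ℂ] ExteriorAlgebra ℂ V)) ^ n *
          (LinearMap.range (ExteriorAlgebra.ι ℂ : V →ₗ[ℂ] ExteriorAlgebra ℂ V)) :=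
        Submodule.mul_mem_mul ω.2 ⟨v, rfl⟩
      rw [← pow_succ] at h
      exact h⟩)
    (fun ω ω' v => Subtype.ext (by simp [add_mul]))
    (fun c ω v => Subtype.ext (by simp))
    (fun ω v v' => Subtype.ext (by simp [mul_add]))
    (fun c ω v => Subtype.ext (by simp))

theorem wedge_tmul (n : ℕ) (ω : ⋀[ℂ]^n V) (v : V) :
    ((wedge V n (ω ⊗ₜ v) : ⋀[ℂ]^(n + 1) V) : ExteriorAlgebra ℂ V) =
      (ω : ExteriorAlgebra ℂ V) * ExteriorAlgebra.ι ℂ v := rfl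

/-- The `n`-forms `Ωⁿ = Λⁿ V ⊗ R3 lam`; `ω ⊗ f` stands for `ω f`. -/
abbrev Form (lam : ℂ) (V : Type*) [AddCommGroup V] [Module ℂ V] (n : ℕ) : Type _ :=
  (⋀[ℂ]^n V) ⊗[ℂ] R3 lam

/-- The standard additive group structure of `Form lam V n` (that of the tensor product), restated
so that its additive monoid is the one of the tensor product also up to reducible unfolding. -/
instance (lam : ℂ) (V : Type*) [AddCommGroup V] [Module ℂ V] (n : ℕ) :
    AddCommGroup (Form lam V n) :=
  { (TensorProduct.addCommGroup : AddCommGroup (Form lam V n)) with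
    toAddMonoid := (TensorProduct.addCommMonoid : AddCommMonoid (Form lam V n)).toAddMonoid }

/-- The exterior derivative: the superderivation that extends `d0` and vanishes on the
invariant forms `Λⁿ V`, that is `d (ω f) = ω ∧ d f`. -/
def d (ρ : R3 lam →ₐ[ℂ] Module.End ℂ V) (L : V) (n : ℕ) :
    Form lam V n →ₗ[ℂ] Form lam V (n + 1) :=
  LinearMap.rTensor (R3 lam) (wedge V n) ∘ₗ
    (TensorProduct.assoc ℂ (⋀[ℂ]^n V) V (R3 lam)).symm.toLinearMap ∘ₗ
    LinearMap.lTensor (⋀[ℂ]^n V) (d0 ρ L)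

/-- Closed `n`-forms. -/
def cocycles (ρ : R3 lam →ₐ[ℂ] Module.End ℂ V) (L : V) (n : ℕ) :
    Submodule ℂ (Form lam V n) :=
  LinearMap.ker (d ρ L n)

/-- Exact `n`-forms. -/
def coboundaries (ρ : R3 lam →ₐ[ℂ] Module.End ℂ V) (L : V) :
    (n : ℕ) → Submodule ℂ (Form lam V n)
  | 0 => ⊥
  | n + 1 => LinearMap.range (d ρ L n)

/-- The equality `d ∘ d = 0`. -/
theorem d_comp_d (ρ : R3 lam →ₐ[ℂ] Module.End ℂ V) (L : V) (n : ℕ) :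
    d ρ L (n + 1) ∘ₗ d ρ L n = 0 := by
  refine TensorProduct.ext' fun ω f => ?_
  let Ψ : (R3 lam) ⊗[ℂ] ((R3 lam) ⊗[ℂ] (R3 lam)) →ₗ[ℂ] Form lam V (n + 1 + 1) :=
    LinearMap.rTensor (R3 lam) (wedge V (n + 1) ∘ₗ TensorProduct.map
      (wedge V n ∘ₗ TensorProduct.mk ℂ _ _ ω ∘ₗ proj ρ L) (proj ρ L)) ∘ₗ
      (TensorProduct.assoc ℂ (R3 lam) (R3 lam) (R3 lam)).symm.toLinearMap
  have hΨ : ∀ a b c : R3 lam, Ψ (a ⊗ₜ (b ⊗ₜ c)) =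
      wedge V (n + 1) (wedge V n (ω ⊗ₜ proj ρ L a) ⊗ₜ proj ρ L b) ⊗ₜ c := fun a b c => rfl
  have h1 : (d ρ L (n + 1) ∘ₗ d ρ L n) (ω ⊗ₜ f) = (lam⁻¹ * lam⁻¹) •
      Ψ (Algebra.TensorProduct.map (.id ℂ (R3 lam)) (comulHom lam) (comulHom lam f)) := by
    have h2 : ∀ (m : ℕ) (η : ⋀[ℂ]^m V) (t : (R3 lam) ⊗[ℂ] (R3 lam)),
        LinearMap.rTensor (R3 lam) (wedge V m) ((TensorProduct.assoc ℂ (⋀[ℂ]^m V) V (R3 lam)).symm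
          (η ⊗ₜ TensorProduct.map (proj ρ L) LinearMap.id t)) =
        TensorProduct.map (wedge V m ∘ₗ TensorProduct.mk ℂ _ _ η ∘ₗ proj ρ L) LinearMap.id t := by
      intro m η t
      induction t with
      | zero => simp
      | add a b ha hb => simp only [map_add, TensorProduct.tmul_add, ha, hb]
      | tmul a b => simp
    have h3 : ∀ (m : ℕ) (η : ⋀[ℂ]^m V) (g : R3 lam), d ρ L m (η ⊗ₜ g) = lam⁻¹ •
        TensorProduct.map (wedge V m ∘ₗ TensorProduct.mk ℂ _ _ η ∘ₗ proj ρ L) LinearMap.id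
          (comulHom lam g) := by
      intro m η g
      rw [← h2]
      simp [d, d0, comul_eq]
    rw [LinearMap.comp_apply, h3, map_smul, mul_smul]
    congr 1
    generalize comulHom lam f = t
    induction t with
    | zero => simp
    | add a b ha hb => simp only [map_add, ha, hb, smul_add]
    | tmul a b =>
      rw [TensorProduct.map_tmul, LinearMap.id_apply, h3, Algebra.TensorProduct.map_tmul]
      congr 1
      generalize comulHom lam b = t
      induction t with
      | zero => simp
      | add u v hu hv => simp only [map_add, TensorProduct.tmul_add, hu, hv]
      | tmul u v => rfl
  have h4 : (Algebra.TensorProduct.leftComm ℂ (R3 lam) (R3 lam) (R3 lam)).toAlgHom.comp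
      ((Algebra.TensorProduct.map (.id ℂ (R3 lam)) (comulHom lam)).comp (comulHom lam)) =
      (Algebra.TensorProduct.map (.id ℂ (R3 lam)) (comulHom lam)).comp (comulHom lam) :=
    algHom_ext lam _ _ fun g => by
      simp [comulHom_gen, TensorProduct.tmul_add, Algebra.TensorProduct.one_def]
      abel
  have h5 : ∀ t : (R3 lam) ⊗[ℂ] ((R3 lam) ⊗[ℂ] (R3 lam)), Ψ (Algebra.TensorProduct.leftComm ℂ (R3 lam) (R3 lam) (R3 lam) t) = - Ψ t := by
    intro t
    induction t with
    | zero => simp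
    | add a b ha hb => simp only [map_add, ha, hb, neg_add]
    | tmul a t =>
      induction t with
      | zero => simp
      | add b c hb hc => simp only [map_add, TensorProduct.tmul_add, hb, hc, neg_add]
      | tmul b c =>
        rw [Algebra.TensorProduct.leftComm_tmul, hΨ, hΨ, ← TensorProduct.neg_tmul]
        congr 1
        refine Subtype.ext ?_
        rw [wedge_tmul, wedge_tmul, Submodule.coe_neg, wedge_tmul, wedge_tmul, mul_assoc,
          mul_assoc, ← mul_neg]
        congr 1
        exact eq_neg_of_add_eq_zero_left (ExteriorAlgebra.ι_add_mul_swap _ _)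
  have h6 := h5 (Algebra.TensorProduct.map (.id ℂ (R3 lam)) (comulHom lam) (comulHom lam f))
  have h7 := DFunLike.congr_fun h4 f
  simp only [AlgHom.comp_apply] at h7
  rw [show Algebra.TensorProduct.leftComm ℂ (R3 lam) (R3 lam) (R3 lam)
    (Algebra.TensorProduct.map (.id ℂ (R3 lam)) (comulHom lam) (comulHom lam f)) = _ from h7] at h6
  have h8 : Ψ (Algebra.TensorProduct.map (.id ℂ (R3 lam)) (comulHom lam) (comulHom lam f)) = 0 := by
    have h9 : (2 : ℂ) • Ψ (Algebra.TensorProduct.map (.id ℂ (R3 lam)) (comulHom lam)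
        (comulHom lam f)) = 0 := by
      rw [two_smul]
      nth_rewrite 1 [h6]
      exact neg_add_cancel _
    exact (smul_eq_zero.mp h9).resolve_left two_ne_zero
  rw [h1, h8, smul_zero]
  rfl

theorem coboundaries_le_cocycles (ρ : R3 lam →ₐ[ℂ] Module.End ℂ V) (L : V) (n : ℕ) :
    coboundaries ρ L n ≤ cocycles ρ L n := by
  cases n with
  | zero => exact bot_le
  | succ n =>
    rintro _ ⟨x, rfl⟩
    exact LinearMap.congr_fun (d_comp_d ρ L n) x

/-- The cohomology `Hⁿ`: closed `n`-forms modulo exact `n`-forms. -/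
abbrev H (ρ : R3 lam →ₐ[ℂ] Module.End ℂ V) (L : V) (n : ℕ) : Type _ :=
  cocycles ρ L n ⧸ (coboundaries ρ L n).submoduleOf (cocycles ρ L n)

/-- The class of a closed form. -/
def H.mk (ρ : R3 lam →ₐ[ℂ] Module.End ℂ V) (L : V) (n : ℕ) (ω : Form lam V n)
    (hω : ω ∈ cocycles ρ L n) : H ρ L n :=
  ((coboundaries ρ L n).submoduleOf (cocycles ρ L n)).mkQ ⟨ω, hω⟩

/-- A function `f`, as a `0`-form. -/
def ofFun (V : Type*) [AddCommGroup V] [Module ℂ V] (f : R3 lam) : Form lam V 0 :=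
  (exteriorPower.zeroEquiv ℂ V).symm 1 ⊗ₜ f

/-- The `1`-form `v f`. -/
def oneForm (v : V) (f : R3 lam) : Form lam V 1 :=
  (exteriorPower.oneEquiv ℂ V).symm v ⊗ₜ f

end Calculus

/-! ### The two representations -/

/-- The spin `1` representation on `ℂ³`, in the basis `e₊, e₀, e₋`. -/
def rho3 (lam : ℂ) : R3 lam →ₐ[ℂ] Module.End ℂ (Fin 3 → ℂ) :=
  (Matrix.toLinAlgEquiv' : Matrix (Fin 3) (Fin 3) ℂ ≃ₐ[ℂ] _).toAlgHom.comp <|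
  lift lam
    (fun
      | Gen.xp => lam • !![0, 2, 0; 0, 0, 1; 0, 0, 0]
      | Gen.xm => lam • !![0, 0, 0; 1, 0, 0; 0, 2, 0]
      | Gen.h => lam • !![2, 0, 0; 0, 0, 0; 0, 0, -2])
    (by ext i j; fin_cases i <;> fin_cases j <;> simp [Matrix.mul_apply, Fin.sum_univ_three] <;>
      ring_nf <;> simp)
    (by ext i j; fin_cases i <;> fin_cases j <;> simp [Matrix.mul_apply, Fin.sum_univ_three] <;>
      ring_nf <;> simp)
    (by ext i j; fin_cases i <;> fin_cases j <;> simp [Matrix.mul_apply, Fin.sum_univ_three] <;>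
      ring)

/-- The vector `e₀` of `ℂ³`. -/
def e0 : Fin 3 → ℂ := ![0, 1, 0]

/-- The spin `1/2` representation on `ℂ²`, in the basis `e₁, e₂`. -/
def rho2 (lam : ℂ) : R3 lam →ₐ[ℂ] Module.End ℂ (Fin 2 → ℂ) :=
  (Matrix.toLinAlgEquiv' : Matrix (Fin 2) (Fin 2) ℂ ≃ₐ[ℂ] _).toAlgHom.comp <|
  lift lam
    (fun
      | Gen.xp => lam • !![0, 1; 0, 0]
      | Gen.xm => lam • !![0, 0; 1, 0]
      | Gen.h => lam • !![1, 0; 0, -1])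
    (by ext i j; fin_cases i <;> fin_cases j <;> simp [Matrix.mul_apply, Fin.sum_univ_two] <;>
      ring)
    (by ext i j; fin_cases i <;> fin_cases j <;> simp [Matrix.mul_apply, Fin.sum_univ_two] <;>
      ring)
    (by ext i j; fin_cases i <;> fin_cases j <;> simp [Matrix.mul_apply, Fin.sum_univ_two])

/-- The vector `e₁` of `ℂ²`. -/
def e1 : Fin 2 → ℂ := ![1, 0]

end R3Calculus

end

noncomputable section

namespace R3Calculus

open Polynomial

/-! ### The Poincaré–Birkhoff–Witt basis -/

/-! Written in the Poincaré–Birkhoff–Witt basis `x₋ᵃ p(h) x₊ᶜ` (the isomorphism `pbw`), the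
differential has constant coefficients. Its components are built from commuting operators: the
formal partial derivatives ∂₋ and ∂₊, and the translations T_s sending `p(h)` to `p(h + s)`. Because
d(ω f) = ω ∧ d f, the forms make up the Koszul complex of these components. Its cohomology is found
by removing one direction at a time, each time with an operator that is onto.

Spin 1 (`d0_rho3`): put A = ∂₊ T_{2λ}. Then d f = e₊ 2Af + e₀ 2λ∂₋Af + e₋ (2∂₋f + 2λ²∂₋²Af). Since A
is onto (`shift_derivXp_surjective`), exact forms absorb the e₊ direction, and the coefficients that
survive lie in ker A. On ker A the differential is just f ↦ 2 e₋ ∂₋f, and every element of ker A is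
∂₋ of an element of ker A (`derivXm_surjective_on_ker`), so the e₋ direction disappears too. What
remains is ker A ∩ ker ∂₋ = ℂ[h] (`exists_aeval_h`), with the single direction e₀ and zero
differential. This contributes one copy of ℂ[h] in degree 0 and one in degree 1.

Spin 1/2 (`d0_rho2`): d f = e₁ λ⁻¹(T_λ − 1)f + e₂ ∂₋T_λ f. The difference operator T_λ − 1 is onto
(`shift_sub_surjective`), its kernel consists of the elements free of h, and ∂₋ is onto within that
kernel (`derivXm_surjective_on_shift_eq`). Both directions disappear, and only the common kernel
ℂ[x₊] (`exists_aeval_xp`) is left, in degree 0. -/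

theorem gen_induction {lam : ℂ} {P : R3 lam → Prop} (f : R3 lam)
    (hC : ∀ c : ℂ, P (algebraMap ℂ (R3 lam) c)) (hg : ∀ g, P (gen lam g))
    (hadd : ∀ a b, P a → P b → P (a + b)) (hmul : ∀ a b, P a → P b → P (a * b)) : P f := by
  obtain ⟨x, rfl⟩ := RingQuot.mkAlgHom_surjective ℂ (Rel lam) f
  induction x using FreeAlgebra.induction with
  | grade0 c =>
    rw [AlgHom.commutes]
    exact hC c
  | grade1 g => exact hg g
  | mul a b ha hb =>
    rw [map_mul]
    exact hmul _ _ ha hb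
  | add a b ha hb =>
    rw [map_add]
    exact hadd _ _ ha hb

/-- The space of normally ordered polynomials: `single (a, c) p` stands for
`x₋ᵃ p(h) x₊ᶜ`. -/
abbrev NormalOrdered : Type := (ℕ × ℕ) →₀ ℂ[X]

/-- Reduces the surjectivity statements below to a single component `x₋ᵃ p(h) x₊ᶜ`, taking for `S` a
range or the image of a kernel. -/
theorem mem_of_single_mem {S : Submodule ℂ NormalOrdered} {m : NormalOrdered}
    (h : ∀ i, Finsupp.single i (m i) ∈ S) : m ∈ S := by
  rw [← Finsupp.sum_single m]
  exact S.sum_mem fun i _ => h i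

/-- Left multiplication by a generator on normally ordered polynomials. -/
def genAction (lam : ℂ) : Gen → Module.End ℂ NormalOrdered
  | Gen.xm => Finsupp.lsum ℂ fun i => Finsupp.lsingle (i.1 + 1, i.2)
  | Gen.h => Finsupp.lsum ℂ fun i =>
      Finsupp.lsingle i ∘ₗ LinearMap.mulLeft ℂ (X - C (2 * lam * i.1))
  -- Moving x₊ past `x₋ᵃ` leaves the commutator aλ `x₋ᵃ⁻¹` (h − λ(a − 1)), and moving it past `p(h)`
  -- turns h into h − 2λ. At a = 0 the truncated exponent `i.1 - 1` is harmless, its coefficient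
  -- being zero.
  | Gen.xp => Finsupp.lsum ℂ fun i =>
      Finsupp.lsingle (i.1, i.2 + 1) ∘ₗ taylor (-(2 * lam)) +
      Finsupp.lsingle (i.1 - 1, i.2) ∘ₗ
        LinearMap.mulLeft ℂ (C (lam * i.1) * (X - C (lam * (i.1 - 1))))

theorem genAction_xm (lam : ℂ) (i : ℕ × ℕ) (p : ℂ[X]) :
    genAction lam Gen.xm (Finsupp.single i p) = Finsupp.single (i.1 + 1, i.2) p := by
  simp [genAction]

theorem genAction_h (lam : ℂ) (i : ℕ × ℕ) (p : ℂ[X]) :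
    genAction lam Gen.h (Finsupp.single i p) =
      Finsupp.single i ((X - C (2 * lam * i.1)) * p) := by
  simp [genAction]

theorem genAction_xp (lam : ℂ) (i : ℕ × ℕ) (p : ℂ[X]) :
    genAction lam Gen.xp (Finsupp.single i p) =
      Finsupp.single (i.1, i.2 + 1) (taylor (-(2 * lam)) p) +
      Finsupp.single (i.1 - 1, i.2) (C (lam * i.1) * (X - C (lam * (i.1 - 1))) * p) := by
  rw [genAction, Finsupp.lsum_single]
  rfl

/-- The representation of the algebra on normally ordered polynomials. -/
def normalAction (lam : ℂ) : R3 lam →ₐ[ℂ] Module.End ℂ NormalOrdered :=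
  lift lam (genAction lam)
    (by
      refine Finsupp.lhom_ext fun ⟨a, c⟩ p => ?_
      simp only [Module.End.mul_apply, LinearMap.add_apply, LinearMap.smul_apply, genAction_h,
        genAction_xp, map_add, taylor_mul, taylor_X, taylor_C, map_sub, smul_add,
        Finsupp.smul_single]
      -- The case a = 0 is separate because of the truncated `a - 1`: there the commutator term
      -- vanishes.
      cases a with
      | zero =>
        simp only [Nat.cast_zero, mul_zero, map_zero, zero_mul, Finsupp.single_zero, add_zero,
          smul_zero, ← Finsupp.single_add]
        congr 1
        simp only [smul_eq_C_mul, C_neg]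
        ring
      | succ a =>
        rw [add_add_add_comm, ← Finsupp.single_add, ← Finsupp.single_add]
        congr 2
        · simp only [smul_eq_C_mul, C_neg]
          ring
        · simp only [smul_eq_C_mul, C_mul, C_sub, Nat.cast_add, Nat.cast_one, map_one, C_add,
            Nat.add_sub_cancel]
          ring)
    (by
      refine Finsupp.lhom_ext fun ⟨a, c⟩ p => ?_
      simp only [Module.End.mul_apply, LinearMap.sub_apply, LinearMap.smul_apply, genAction_h,
        genAction_xm, Finsupp.smul_single, ← Finsupp.single_sub]
      congr 1
      simp only [smul_eq_C_mul, Nat.cast_add, Nat.cast_one, mul_add, mul_one, C_add]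
      ring)
    (by
      refine Finsupp.lhom_ext fun ⟨a, c⟩ p => ?_
      simp only [Module.End.mul_apply, LinearMap.add_apply, LinearMap.smul_apply, genAction_h,
        genAction_xm, genAction_xp, map_add, Finsupp.smul_single, Nat.add_sub_cancel]
      rw [add_assoc]
      congr 1
      cases a with
      | zero =>
        simp only [Nat.cast_zero, mul_zero, map_zero, zero_mul, Finsupp.single_zero, zero_add]
        congr 1
        simp [smul_eq_C_mul, mul_assoc]
      | succ a =>
        simp only [Nat.add_sub_cancel, ← Finsupp.single_add]
        congr 1
        simp only [smul_eq_C_mul, C_add, C_mul, Nat.cast_add, Nat.cast_one, C_sub, map_one,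
          map_ofNat]
        ring)

/-- The element of the algebra given by a normally ordered polynomial. -/
def ofNormal (lam : ℂ) : NormalOrdered →ₗ[ℂ] R3 lam :=
  Finsupp.lsum ℂ fun i => LinearMap.mulRight ℂ (gen lam Gen.xp ^ i.2) ∘ₗ
    LinearMap.mulLeft ℂ (gen lam Gen.xm ^ i.1) ∘ₗ (aeval (gen lam Gen.h)).toLinearMap

theorem ofNormal_single (lam : ℂ) (i : ℕ × ℕ) (p : ℂ[X]) :
    ofNormal lam (Finsupp.single i p) =
      gen lam Gen.xm ^ i.1 * aeval (gen lam Gen.h) p * gen lam Gen.xp ^ i.2 := by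
  simp [ofNormal]

theorem h_mul_xm_pow (lam : ℂ) (a : ℕ) : gen lam Gen.h * gen lam Gen.xm ^ a =
    gen lam Gen.xm ^ a * (gen lam Gen.h - algebraMap ℂ _ (2 * lam * a)) := by
  induction a with
  | zero => simp
  | succ a ih =>
    rw [pow_succ, ← mul_assoc, ih, mul_assoc, sub_mul, gen_h_xm, ← Algebra.smul_def,
      mul_assoc (gen lam Gen.xm ^ a)]
    congr 1
    rw [mul_sub, Algebra.algebraMap_eq_smul_one, mul_smul_comm, mul_one, sub_sub, ← add_smul]
    push_cast
    ring_nf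

theorem xp_mul_xm_pow (lam : ℂ) (a : ℕ) : gen lam Gen.xp * gen lam Gen.xm ^ a =
    gen lam Gen.xm ^ a * gen lam Gen.xp + gen lam Gen.xm ^ (a - 1) *
      ((lam * a) • (gen lam Gen.h - algebraMap ℂ _ (lam * (a - 1)))) := by
  induction a with
  | zero => simp
  | succ a ih =>
    rw [pow_succ', ← mul_assoc, gen_xp_xm, add_mul, mul_assoc, ih, smul_mul_assoc, h_mul_xm_pow,
      mul_add, ← mul_assoc, add_assoc, Nat.add_sub_cancel]
    congr 1
    have : gen lam Gen.xm * (gen lam Gen.xm ^ (a - 1) *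
        ((lam * a) • (gen lam Gen.h - algebraMap ℂ _ (lam * (a - 1))))) =
        gen lam Gen.xm ^ a * ((lam * a) • (gen lam Gen.h - algebraMap ℂ _ (lam * (a - 1)))) := by
      cases a with
      | zero => simp
      | succ a => rw [← mul_assoc, Nat.add_sub_cancel, ← pow_succ']
    rw [this, ← mul_smul_comm, ← mul_add]
    congr 1
    simp only [Algebra.algebraMap_eq_smul_one]
    push_cast
    match_scalars <;> ring

theorem xp_mul_aeval_h (lam : ℂ) (p : ℂ[X]) : gen lam Gen.xp * aeval (gen lam Gen.h) p =
    aeval (gen lam Gen.h) (taylor (-(2 * lam)) p) * gen lam Gen.xp := by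
  induction p using Polynomial.induction_on with
  | C a => simp [Algebra.commutes]
  | add p q hp hq => simp only [map_add, mul_add, add_mul, hp, hq]
  | monomial n a ih =>
    rw [pow_succ, ← mul_assoc]
    generalize C a * X ^ n = q at ih
    rw [map_mul, ← mul_assoc, ih, taylor_mul, map_mul, mul_assoc, mul_assoc]
    congr 1
    rw [taylor_X, map_add, aeval_X, aeval_C, add_mul, gen_h_xp, ← Algebra.smul_def]
    module

theorem ofNormal_genAction (lam : ℂ) (g : Gen) (m : NormalOrdered) :
    ofNormal lam (genAction lam g m) = gen lam g * ofNormal lam m := by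
  suffices h : ofNormal lam ∘ₗ genAction lam g =
      LinearMap.mulLeft ℂ (gen lam g) ∘ₗ ofNormal lam from LinearMap.congr_fun h m
  refine Finsupp.lhom_ext fun ⟨a, c⟩ p => ?_
  simp only [LinearMap.comp_apply, LinearMap.mulLeft_apply, ofNormal_single]
  cases g with
  | xm => simp [genAction_xm, ofNormal_single, pow_succ', mul_assoc]
  | h =>
    rw [genAction_h, ofNormal_single, ← mul_assoc, ← mul_assoc, h_mul_xm_pow]
    simp [mul_assoc]
  | xp =>
    rw [genAction_xp, map_add, ofNormal_single, ofNormal_single, ← mul_assoc, ← mul_assoc,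
      xp_mul_xm_pow, add_mul, add_mul]
    congr 1
    · rw [mul_assoc (gen lam Gen.xm ^ a) (gen lam Gen.xp), xp_mul_aeval_h]
      simp [mul_assoc, pow_succ']
    · simp [mul_assoc, Algebra.smul_def]

/-- At m = 1 this shows that normally ordered polynomials span the algebra, since f is recovered
from its action on 1. -/
theorem ofNormal_normalAction (lam : ℂ) (f : R3 lam) (m : NormalOrdered) :
    ofNormal lam (normalAction lam f m) = f * ofNormal lam m := by
  induction f using gen_induction generalizing m with
  | hC c => simp [Algebra.algebraMap_eq_smul_one]
  | hg g => rw [normalAction, lift_gen, ofNormal_genAction]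
  | hadd a b ha hb => rw [map_add, LinearMap.add_apply, map_add, ha, hb, add_mul]
  | hmul a b ha hb => rw [map_mul, Module.End.mul_apply, ha, hb, mul_assoc]

theorem genAction_h_aeval (lam : ℂ) (c : ℕ) (p q : ℂ[X]) :
    aeval (genAction lam Gen.h) p (Finsupp.single (0, c) q) = Finsupp.single (0, c) (p * q) := by
  induction p using Polynomial.induction_on with
  | C a => simp [Algebra.algebraMap_eq_smul_one, smul_eq_C_mul]
  | add p q hp hq => rw [map_add, LinearMap.add_apply, hp, hq, add_mul, Finsupp.single_add]
  | monomial n a ih =>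
    rw [pow_succ', mul_left_comm, map_mul, Module.End.mul_apply, ih, aeval_X, genAction_h]
    simp [mul_assoc]

/-- The independence half of Poincaré–Birkhoff–Witt. Applied to 1, the factors act from the right:
`x₊ᶜ` creates the index (0, c), `p(h)` multiplies by p as no x₋ is present yet, and `x₋ᵃ` raises the
first index. -/
theorem normalAction_ofNormal (lam : ℂ) (m : NormalOrdered) :
    normalAction lam (ofNormal lam m) (Finsupp.single (0, 0) 1) = m := by
  suffices h : (LinearMap.applyₗ (Finsupp.single (0, 0) 1) ∘ₗ
      (normalAction lam).toLinearMap) ∘ₗ ofNormal lam = LinearMap.id from LinearMap.congr_fun h m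
  refine Finsupp.lhom_ext fun ⟨a, c⟩ p => ?_
  have hg (g) : normalAction lam (gen lam g) = genAction lam g := lift_gen lam _ _ _ _ g
  have hxp : (genAction lam Gen.xp ^ c) (Finsupp.single (0, 0) 1) =
      Finsupp.single (0, c) (1 : ℂ[X]) := by
    induction c with
    | zero => rfl
    | succ c ih =>
      rw [pow_succ', Module.End.mul_apply, ih, genAction_xp]
      simp
  have hxm (q : ℂ[X]) : (genAction lam Gen.xm ^ a) (Finsupp.single (0, c) q) =
      Finsupp.single (a, c) q := by
    induction a with
    | zero => rfl
    | succ a ih => rw [pow_succ', Module.End.mul_apply, ih, genAction_xm]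
  simp only [LinearMap.comp_apply, AlgHom.toLinearMap_apply, LinearMap.applyₗ_apply_apply,
    LinearMap.id_apply]
  rw [ofNormal_single, map_mul, map_mul, map_pow, map_pow, ← aeval_algHom_apply, hg, hg, hg,
    Module.End.mul_apply, Module.End.mul_apply, hxp, genAction_h_aeval, hxm, mul_one]

/-- The Poincaré–Birkhoff–Witt isomorphism. -/
def pbw (lam : ℂ) : NormalOrdered ≃ₗ[ℂ] R3 lam :=
  .ofLinearMap (ofNormal lam)
    (LinearMap.applyₗ (Finsupp.single (0, 0) 1) ∘ₗ (normalAction lam).toLinearMap)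
    (LinearMap.ext fun f => by
      simp [ofNormal_normalAction, ofNormal_single])
    (LinearMap.ext fun m => by
      simp [normalAction_ofNormal])

theorem pbw_single (lam : ℂ) (i : ℕ × ℕ) (p : ℂ[X]) :
    pbw lam (Finsupp.single i p) =
      gen lam Gen.xm ^ i.1 * aeval (gen lam Gen.h) p * gen lam Gen.xp ^ i.2 :=
  ofNormal_single lam i p

/-! ### Translation operators and partial derivatives -/

theorem taylor_sub_self_surjective {s : ℂ} (hs : s ≠ 0) (p : ℂ[X]) :
    ∃ q : ℂ[X], taylor s q - q = p := by
  suffices h : ∀ n : ℕ, ∀ p : ℂ[X], p.degree < n → ∃ q : ℂ[X], taylor s q - q = p from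
    h (p.natDegree + 1) p (degree_lt_iff_coeff_zero _ _ |>.2 fun m hm =>
      coeff_eq_zero_of_natDegree_lt hm)
  intro n
  induction n with
  | zero =>
    intro p hp
    rw [degree_lt_iff_coeff_zero] at hp
    exact ⟨0, by ext k; simp [hp k (Nat.zero_le k)]⟩
  | succ n ih =>
    intro p hp
    -- The difference (X + s)ⁿ⁺¹ − Xⁿ⁺¹ has leading term (n + 1) s Xⁿ, so r cancels the coefficient
    -- of Xⁿ in p.
    let r : ℂ[X] := C (p.coeff n / (s * (n + 1))) * X ^ (n + 1)
    have hr : (p - (taylor s r - r)).degree < n := by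
      rw [degree_lt_iff_coeff_zero] at hp ⊢
      intro m hm
      have hn : (n : ℂ) + 1 ≠ 0 := by exact_mod_cast n.succ_ne_zero
      simp only [r, taylor_mul, taylor_C, taylor_pow, taylor_X, coeff_sub, coeff_C_mul,
        coeff_X_add_C_pow, coeff_X_pow]
      rcases hm.eq_or_lt with rfl | hm
      · simp
        field_simp
        ring
      · rw [hp m hm]
        rcases (Nat.succ_le_of_lt hm).eq_or_lt with rfl | hm
        · simp
        · rw [Nat.choose_eq_zero_of_lt hm]
          simp [hm.ne']
    obtain ⟨q, hq⟩ := ih _ hr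
    exact ⟨q + r, by rw [map_add, ← sub_add_sub_comm, hq, sub_add_cancel]⟩

/-- A polynomial of period s ≠ 0 takes its value at 0 at infinitely many points s n. -/
theorem eq_C_of_taylor_eq {s : ℂ} (hs : s ≠ 0) {p : ℂ[X]} (hp : taylor s p = p) :
    p = C (p.coeff 0) := by
  have h (n : ℕ) : p.eval (s * n) = p.eval 0 := by
    induction n with
    | zero => simp
    | succ n ih =>
      rw [← ih]
      conv_rhs => rw [← hp, taylor_eval]
      push_cast
      ring_nf
  have hinj : Function.Injective fun n : ℕ => s * (n : ℂ) := fun a b hab => by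
    simpa [hs] using hab
  refine eq_of_infinite_eval_eq p _ ((Set.infinite_range_of_injective hinj).mono ?_)
  rintro _ ⟨n, rfl⟩
  simpa [coeff_zero_eq_eval_zero] using h n

/-- The translation `x₋ᵃ p(h) x₊ᶜ ↦ x₋ᵃ p(h + s) x₊ᶜ`. -/
def shiftN (s : ℂ) : Module.End ℂ NormalOrdered :=
  Finsupp.lsum ℂ fun i => Finsupp.lsingle i ∘ₗ taylor s

/-- The partial derivative with respect to `x₋`. -/
def derivXmN : Module.End ℂ NormalOrdered :=
  Finsupp.lsum ℂ fun i => (i.1 : ℂ) • Finsupp.lsingle (i.1 - 1, i.2)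

/-- The partial derivative with respect to `x₊`. -/
def derivXpN : Module.End ℂ NormalOrdered :=
  Finsupp.lsum ℂ fun i => (i.2 : ℂ) • Finsupp.lsingle (i.1, i.2 - 1)

theorem shiftN_single (s : ℂ) (i : ℕ × ℕ) (p : ℂ[X]) :
    shiftN s (Finsupp.single i p) = Finsupp.single i (taylor s p) := by
  rw [shiftN, Finsupp.lsum_single]
  rfl

theorem derivXmN_single (i : ℕ × ℕ) (p : ℂ[X]) :
    derivXmN (Finsupp.single i p) = (i.1 : ℂ) • Finsupp.single (i.1 - 1, i.2) p := by
  rw [derivXmN, Finsupp.lsum_single]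
  rfl

theorem derivXpN_single (i : ℕ × ℕ) (p : ℂ[X]) :
    derivXpN (Finsupp.single i p) = (i.2 : ℂ) • Finsupp.single (i.1, i.2 - 1) p := by
  rw [derivXpN, Finsupp.lsum_single]
  rfl

theorem shiftN_apply (s : ℂ) (m : NormalOrdered) (i : ℕ × ℕ) :
    shiftN s m i = taylor s (m i) := by
  suffices h : Finsupp.lapply i ∘ₗ shiftN s = taylor s ∘ₗ Finsupp.lapply i from
    LinearMap.congr_fun h m
  refine Finsupp.lhom_ext fun j p => ?_
  by_cases hij : j = i <;> simp [shiftN_single, hij]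

theorem derivXmN_apply (m : NormalOrdered) (a c : ℕ) :
    derivXmN m (a, c) = ((a + 1 : ℕ) : ℂ) • m (a + 1, c) := by
  suffices h : Finsupp.lapply (a, c) ∘ₗ derivXmN =
      ((a + 1 : ℕ) : ℂ) • (Finsupp.lapply (a + 1, c) : NormalOrdered →ₗ[ℂ] ℂ[X]) from
    LinearMap.congr_fun h m
  refine Finsupp.lhom_ext fun ⟨b, e⟩ p => ?_
  cases b with
  | zero => simp [derivXmN_single]
  | succ b =>
    by_cases h : b = a
    · subst h
      simp [derivXmN_single, Finsupp.single_apply]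
    · simp [derivXmN_single, h]

theorem derivXpN_apply (m : NormalOrdered) (a c : ℕ) :
    derivXpN m (a, c) = ((c + 1 : ℕ) : ℂ) • m (a, c + 1) := by
  suffices h : Finsupp.lapply (a, c) ∘ₗ derivXpN =
      ((c + 1 : ℕ) : ℂ) • (Finsupp.lapply (a, c + 1) : NormalOrdered →ₗ[ℂ] ℂ[X]) from
    LinearMap.congr_fun h m
  refine Finsupp.lhom_ext fun ⟨b, e⟩ p => ?_
  cases e with
  | zero => simp [derivXpN_single]
  | succ e =>
    by_cases h : e = c
    · subst h
      simp [derivXpN_single, Finsupp.single_apply]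
    · simp [derivXpN_single, h]

/-- The translation `x₋ᵃ p(h) x₊ᶜ ↦ x₋ᵃ p(h + s) x₊ᶜ` on the algebra. -/
def shift (lam s : ℂ) : Module.End ℂ (R3 lam) := (pbw lam).conj (shiftN s)

/-- The partial derivative with respect to `x₋` on the algebra, in normal ordering. -/
def derivXm (lam : ℂ) : Module.End ℂ (R3 lam) := (pbw lam).conj derivXmN

/-- The partial derivative with respect to `x₊` on the algebra, in normal ordering. -/
def derivXp (lam : ℂ) : Module.End ℂ (R3 lam) := (pbw lam).conj derivXpN

theorem shift_pbw (lam s : ℂ) (m : NormalOrdered) :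
    shift lam s (pbw lam m) = pbw lam (shiftN s m) := by
  simp [shift, LinearEquiv.conj_apply]

theorem derivXm_pbw (lam : ℂ) (m : NormalOrdered) :
    derivXm lam (pbw lam m) = pbw lam (derivXmN m) := by
  simp [derivXm, LinearEquiv.conj_apply]

theorem derivXp_pbw (lam : ℂ) (m : NormalOrdered) :
    derivXp lam (pbw lam m) = pbw lam (derivXpN m) := by
  simp [derivXp, LinearEquiv.conj_apply]

theorem pbw_surjective {lam : ℂ} (f : R3 lam) : ∃ m, pbw lam m = f := (pbw lam).surjective f

/-! ### Kernels and images of the operators -/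

theorem shift_derivXp_surjective (lam s : ℂ) (f : R3 lam) :
    ∃ g, derivXp lam (shift lam s g) = f := by
  obtain ⟨m, rfl⟩ := pbw_surjective f
  suffices h : m ∈ LinearMap.range (derivXpN ∘ₗ shiftN s) by
    obtain ⟨n, hn⟩ := h
    exact ⟨pbw lam n, by rw [shift_pbw, derivXp_pbw, ← hn, LinearMap.comp_apply]⟩
  refine mem_of_single_mem fun ⟨a, c⟩ => ⟨((c + 1 : ℕ) : ℂ)⁻¹ •
    Finsupp.single (a, c + 1) (taylor (-s) (m (a, c))), ?_⟩
  rw [LinearMap.comp_apply, map_smul, map_smul, shiftN_single, derivXpN_single, smul_smul,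
    inv_mul_cancel₀ (by exact_mod_cast c.succ_ne_zero), one_smul, taylor_taylor]
  simp

theorem shift_derivXp_eq_zero_iff (lam s : ℂ) (m : NormalOrdered) :
    derivXp lam (shift lam s (pbw lam m)) = 0 ↔ ∀ a c, m (a, c + 1) = 0 := by
  rw [shift_pbw, derivXp_pbw, LinearEquiv.map_eq_zero_iff, Finsupp.ext_iff, Prod.forall]
  refine forall₂_congr fun a c => ?_
  rw [derivXpN_apply, shiftN_apply, Finsupp.zero_apply, smul_eq_zero_iff_right
    (by exact_mod_cast c.succ_ne_zero), map_eq_zero_iff _ (taylor_injective s)]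

/-- The kernel of ∂₊ T_s consists of the elements without x₊, and integrating in x₋ introduces no
x₊. -/
theorem derivXm_surjective_on_ker (lam s : ℂ) (f : R3 lam)
    (hf : derivXp lam (shift lam s f) = 0) :
    ∃ g, derivXp lam (shift lam s g) = 0 ∧ derivXm lam g = f := by
  obtain ⟨m, rfl⟩ := pbw_surjective f
  rw [shift_derivXp_eq_zero_iff] at hf
  suffices h : m ∈ (LinearMap.ker (derivXp lam ∘ₗ shift lam s ∘ₗ (pbw lam).toLinearMap)).map
      derivXmN by
    obtain ⟨n, hn, rfl⟩ := h
    exact ⟨pbw lam n, hn, derivXm_pbw lam n⟩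
  refine mem_of_single_mem fun ⟨a, c⟩ => ?_
  cases c with
  | succ c =>
    rw [hf, Finsupp.single_zero]
    exact zero_mem _
  | zero =>
    refine ⟨((a + 1 : ℕ) : ℂ)⁻¹ • Finsupp.single (a + 1, 0) (m (a, 0)), ?_, ?_⟩
    · refine Submodule.smul_mem _ _ ((shift_derivXp_eq_zero_iff lam s _).2 fun b e => ?_)
      simp
    · rw [map_smul, derivXmN_single, smul_smul,
        inv_mul_cancel₀ (by exact_mod_cast a.succ_ne_zero), one_smul]
      rfl

theorem aeval_h_eq_pbw (lam : ℂ) (p : ℂ[X]) :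
    aeval (gen lam Gen.h) p = pbw lam (Finsupp.single (0, 0) p) := by
  simp [pbw_single]

theorem aeval_h_injective {lam : ℂ} {p : ℂ[X]} (hp : aeval (gen lam Gen.h) p = 0) : p = 0 := by
  simpa [aeval_h_eq_pbw] using hp

theorem derivXm_aeval_h (lam : ℂ) (p : ℂ[X]) : derivXm lam (aeval (gen lam Gen.h) p) = 0 := by
  simp [aeval_h_eq_pbw, derivXm_pbw, derivXmN_single]

theorem derivXp_shift_aeval_h (lam s : ℂ) (p : ℂ[X]) :
    derivXp lam (shift lam s (aeval (gen lam Gen.h) p)) = 0 := by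
  simp [aeval_h_eq_pbw, derivXp_pbw, shift_pbw, derivXpN_single, shiftN_single]

theorem exists_aeval_h {lam s : ℂ} {f : R3 lam} (hp : derivXp lam (shift lam s f) = 0)
    (hm : derivXm lam f = 0) : ∃ p : ℂ[X], aeval (gen lam Gen.h) p = f := by
  obtain ⟨m, rfl⟩ := pbw_surjective f
  rw [shift_derivXp_eq_zero_iff] at hp
  rw [derivXm_pbw, LinearEquiv.map_eq_zero_iff] at hm
  refine ⟨m (0, 0), ?_⟩
  rw [aeval_h_eq_pbw]
  congr 1
  ext1 ⟨a, c⟩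
  cases c with
  | succ c => simp [hp]
  | zero =>
    cases a with
    | zero => simp
    | succ a =>
      have h := derivXmN_apply m a 0
      rw [hm, Finsupp.zero_apply, eq_comm,
        smul_eq_zero_iff_right (by exact_mod_cast a.succ_ne_zero)] at h
      simp [h]

theorem shift_sub_surjective (lam : ℂ) {s : ℂ} (hs : s ≠ 0) (f : R3 lam) :
    ∃ g, shift lam s g - g = f := by
  obtain ⟨m, rfl⟩ := pbw_surjective f
  suffices h : m ∈ LinearMap.range (shiftN s - LinearMap.id) by
    obtain ⟨n, hn⟩ := h
    exact ⟨pbw lam n, by rw [shift_pbw, ← hn, ← map_sub]; rfl⟩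
  refine mem_of_single_mem fun i => ?_
  obtain ⟨q, hq⟩ := taylor_sub_self_surjective hs (m i)
  refine ⟨Finsupp.single i q, ?_⟩
  rw [LinearMap.sub_apply, shiftN_single, LinearMap.id_apply, ← Finsupp.single_sub, hq]

theorem shift_pbw_eq_self_iff (lam : ℂ) {s : ℂ} (hs : s ≠ 0) (m : NormalOrdered) :
    shift lam s (pbw lam m) = pbw lam m ↔ ∀ i, m i = C ((m i).coeff 0) := by
  rw [shift_pbw, EmbeddingLike.apply_eq_iff_eq, Finsupp.ext_iff]
  refine forall_congr' fun i => ?_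
  rw [shiftN_apply]
  refine ⟨eq_C_of_taylor_eq hs, fun h => ?_⟩
  rw [h, taylor_C]

/-- Translation-invariant elements have coefficients constant in h, and integration in x₋ only
rescales these coefficients. -/
theorem derivXm_surjective_on_shift_eq (lam : ℂ) {s : ℂ} (hs : s ≠ 0) (f : R3 lam)
    (hf : shift lam s f = f) : ∃ g, shift lam s g = g ∧ derivXm lam g = f := by
  obtain ⟨m, rfl⟩ := pbw_surjective f
  rw [shift_pbw_eq_self_iff lam hs] at hf
  suffices h : m ∈ (LinearMap.ker ((shift lam s - LinearMap.id) ∘ₗ (pbw lam).toLinearMap)).map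
      derivXmN by
    obtain ⟨n, hn, rfl⟩ := h
    exact ⟨pbw lam n, sub_eq_zero.1 hn, derivXm_pbw lam n⟩
  refine mem_of_single_mem fun ⟨a, c⟩ => ?_
  refine ⟨((a + 1 : ℕ) : ℂ)⁻¹ • Finsupp.single (a + 1, c) (m (a, c)), ?_, ?_⟩
  · refine Submodule.smul_mem _ _ (sub_eq_zero.2 ((shift_pbw_eq_self_iff lam hs _).2 fun i => ?_))
    rw [Finsupp.single_apply]
    split_ifs
    · exact hf _
    · simp
  · rw [map_smul, derivXmN_single, smul_smul,
      inv_mul_cancel₀ (by exact_mod_cast a.succ_ne_zero), one_smul]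
    rfl

theorem exists_pbw_eq_aeval_xp (lam : ℂ) (p : ℂ[X]) : ∃ m : NormalOrdered,
    pbw lam m = aeval (gen lam Gen.xp) p ∧
      ∀ a c, m (a, c) = if a = 0 then C (p.coeff c) else 0 := by
  induction p using Polynomial.induction_on' with
  | add p q hp hq =>
    obtain ⟨m, hm, hm'⟩ := hp
    obtain ⟨n, hn, hn'⟩ := hq
    refine ⟨m + n, by rw [map_add, map_add, hm, hn], fun a c => ?_⟩
    rw [Finsupp.add_apply, hm', hn']
    split_ifs <;> simp
  | monomial k z =>
    refine ⟨Finsupp.single (0, k) (C z), ?_, fun a c => ?_⟩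
    · rw [pbw_single, aeval_monomial]
      simp
    · rw [Finsupp.single_apply, coeff_monomial]
      by_cases ha : a = 0 <;> by_cases hc : k = c <;> simp [ha, hc, eq_comm]

theorem aeval_xp_injective {lam : ℂ} {p : ℂ[X]} (hp : aeval (gen lam Gen.xp) p = 0) : p = 0 := by
  obtain ⟨m, hm, hm'⟩ := exists_pbw_eq_aeval_xp lam p
  rw [hp, LinearEquiv.map_eq_zero_iff] at hm
  ext c
  simpa [hm] using (hm' 0 c).symm

theorem shift_aeval_xp (lam : ℂ) {s : ℂ} (hs : s ≠ 0) (p : ℂ[X]) :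
    shift lam s (aeval (gen lam Gen.xp) p) = aeval (gen lam Gen.xp) p := by
  obtain ⟨m, hm, hm'⟩ := exists_pbw_eq_aeval_xp lam p
  rw [← hm, shift_pbw_eq_self_iff lam hs]
  rintro ⟨a, c⟩
  rw [hm']
  split_ifs <;> simp

theorem derivXm_aeval_xp (lam : ℂ) (p : ℂ[X]) :
    derivXm lam (aeval (gen lam Gen.xp) p) = 0 := by
  obtain ⟨m, hm, hm'⟩ := exists_pbw_eq_aeval_xp lam p
  rw [← hm, derivXm_pbw, LinearEquiv.map_eq_zero_iff]
  ext1 ⟨a, c⟩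
  simp [derivXmN_apply, hm']

theorem exists_aeval_xp {lam s : ℂ} (hs : s ≠ 0) {f : R3 lam} (h : shift lam s f = f)
    (hm : derivXm lam f = 0) : ∃ p : ℂ[X], aeval (gen lam Gen.xp) p = f := by
  obtain ⟨m, rfl⟩ := pbw_surjective f
  rw [shift_pbw_eq_self_iff lam hs] at h
  rw [derivXm_pbw, LinearEquiv.map_eq_zero_iff] at hm
  suffices hS : m ∈ (LinearMap.range (aeval (gen lam Gen.xp)).toLinearMap).comap
      (pbw lam).toLinearMap from hS
  refine mem_of_single_mem fun ⟨a, c⟩ => ?_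
  cases a with
  | zero =>
    refine ⟨monomial c ((m (0, c)).coeff 0), ?_⟩
    conv_rhs => rw [h]
    simp [pbw_single, aeval_monomial]
  | succ a =>
    have h := derivXmN_apply m a c
    rw [hm, Finsupp.zero_apply, eq_comm,
      smul_eq_zero_iff_right (by exact_mod_cast a.succ_ne_zero)] at h
    simp [h]

/-! ### The differential of a function in normal ordering -/

section LeftMul

variable {lam : ℂ} {V : Type*} [AddCommGroup V] [Module ℂ V] (ρ : R3 lam →ₐ[ℂ] Module.End ℂ V)

theorem leftMul_gen_tmul (g : Gen) (v : V) (f : R3 lam) :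
    leftMul ρ (gen lam g) (v ⊗ₜ f) = v ⊗ₜ (gen lam g * f) + ρ (gen lam g) v ⊗ₜ f := by
  rw [leftMul, AlgHom.comp_apply, AlgHom.comp_apply, comulHom_gen, map_add, map_add,
    Algebra.TensorProduct.map_tmul, Algebra.TensorProduct.map_tmul, LinearMap.add_apply,
    Module.endTensorEndAlgHom_apply, Module.endTensorEndAlgHom_apply]
  simp [add_comm]

/-- Since h v = v (h + μ) on a vector of weight μ, the translations in d are by weights of ρ. -/
theorem leftMul_aeval_h_tmul {μ : ℂ} {v : V} (hv : ρ (gen lam Gen.h) v = μ • v) (p : ℂ[X])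
    (f : R3 lam) : leftMul ρ (aeval (gen lam Gen.h) p) (v ⊗ₜ f) =
      v ⊗ₜ (aeval (gen lam Gen.h) (taylor μ p) * f) := by
  induction p using Polynomial.induction_on with
  | C a => simp [Algebra.algebraMap_eq_smul_one]
  | add p q hp hq => rw [map_add, map_add, LinearMap.add_apply, hp, hq, map_add, map_add, add_mul,
      TensorProduct.tmul_add]
  | monomial n a ih =>
    rw [pow_succ', mul_left_comm]
    generalize C a * X ^ n = q at ih
    rw [map_mul, map_mul, Module.End.mul_apply, ih, aeval_X, leftMul_gen_tmul, hv, taylor_mul,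
      taylor_X, map_mul, TensorProduct.smul_tmul, ← TensorProduct.tmul_add]
    simp [add_mul, mul_assoc, Algebra.smul_def]

/-- The binomial theorem for the commuting summands ξ ⊗ 1 and 1 ⊗ ξ of Δξ, cut off after the
quadratic term because ρ(ξ)³ v = 0. Truncated exponents occur only with a zero coefficient. -/
theorem leftMul_gen_pow_tmul (g : Gen) {v w z : V} (hv : ρ (gen lam g) v = w)
    (hw : ρ (gen lam g) w = z) (hz : ρ (gen lam g) z = 0) (n : ℕ) (f : R3 lam) :
    leftMul ρ (gen lam g ^ n) (v ⊗ₜ f) = v ⊗ₜ (gen lam g ^ n * f) +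
      w ⊗ₜ ((n : ℂ) • (gen lam g ^ (n - 1) * f)) +
      z ⊗ₜ ((n.choose 2 : ℂ) • (gen lam g ^ (n - 2) * f)) := by
  induction n with
  | zero => simp
  | succ n ih =>
    have h1 : gen lam g * ((n : ℂ) • (gen lam g ^ (n - 1) * f)) =
        (n : ℂ) • (gen lam g ^ n * f) := by
      cases n with
      | zero => simp
      | succ n => rw [mul_smul_comm, ← mul_assoc, ← pow_succ', Nat.add_sub_cancel]
    have h2 : gen lam g * ((n.choose 2 : ℂ) • (gen lam g ^ (n - 2) * f)) =
        (n.choose 2 : ℂ) • (gen lam g ^ (n - 1) * f) := by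
      match n with
      | 0 => simp
      | 1 => simp
      | n + 2 => rw [mul_smul_comm, ← mul_assoc, ← pow_succ']; rfl
    rw [pow_succ', map_mul, Module.End.mul_apply, ih, map_add, map_add, leftMul_gen_tmul,
      leftMul_gen_tmul, leftMul_gen_tmul, hv, hw, hz, h1, h2, TensorProduct.zero_tmul, add_zero,
      Nat.choose_succ_succ' n 1, Nat.choose_one_right, Nat.add_sub_cancel,
      show n + 1 - 2 = n - 1 by omega, ← mul_assoc]
    push_cast
    rw [add_smul, add_smul, one_smul, TensorProduct.tmul_add, TensorProduct.tmul_add]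
    abel

end LeftMul

theorem rho2_xp_e1 (lam : ℂ) : rho2 lam (gen lam Gen.xp) e1 = 0 := by
  rw [rho2, AlgHom.comp_apply, lift_gen]
  ext i
  fin_cases i <;> simp [e1]

theorem rho2_h_e1 (lam : ℂ) : rho2 lam (gen lam Gen.h) e1 = lam • e1 := by
  rw [rho2, AlgHom.comp_apply, lift_gen]
  ext i
  fin_cases i <;> simp [e1]

theorem rho2_xm_e1 (lam : ℂ) : rho2 lam (gen lam Gen.xm) e1 = lam • ![0, 1] := by
  rw [rho2, AlgHom.comp_apply, lift_gen]
  ext i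
  fin_cases i <;> simp [e1]

theorem rho2_xm_xm_e1 (lam : ℂ) : rho2 lam (gen lam Gen.xm) (lam • ![0, 1]) = 0 := by
  rw [rho2, AlgHom.comp_apply, lift_gen]
  ext i
  fin_cases i <;> simp

theorem d0_rho2 {lam : ℂ} (hlam : lam ≠ 0) (f : R3 lam) :
    d0 (rho2 lam) e1 f = e1 ⊗ₜ (lam⁻¹ • (shift lam lam f - f)) +
      ![0, 1] ⊗ₜ derivXm lam (shift lam lam f) := by
  obtain ⟨m, rfl⟩ := pbw_surjective f
  suffices h : d0 (rho2 lam) e1 ∘ₗ (pbw lam).toLinearMap =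
      (TensorProduct.mk ℂ _ _ e1 ∘ₗ (lam⁻¹ • (shift lam lam - LinearMap.id)) +
        TensorProduct.mk ℂ _ _ ![0, 1] ∘ₗ derivXm lam ∘ₗ shift lam lam) ∘ₗ
        (pbw lam).toLinearMap from LinearMap.congr_fun h m
  refine Finsupp.lhom_ext fun ⟨a, c⟩ p => ?_
  simp only [LinearMap.comp_apply, LinearMap.add_apply, LinearMap.smul_apply,
    LinearMap.sub_apply, LinearEquiv.coe_coe, TensorProduct.mk_apply, LinearMap.id_apply,
    shift_pbw, derivXm_pbw, shiftN_single, derivXmN_single, map_smul, d0_eq]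
  simp only [pbw_single, map_mul, Module.End.mul_apply]
  -- The factors act on e₁ from the right: x₊ kills e₁, the weight λ of e₁ yields the translation by
  -- λ, and x₋ carries e₁ to λ e₂.
  rw [leftMul_gen_pow_tmul (rho2 lam) Gen.xp (rho2_xp_e1 lam) (map_zero _) (map_zero _)]
  simp only [TensorProduct.zero_tmul, add_zero, mul_one]
  rw [leftMul_aeval_h_tmul (rho2 lam) (rho2_h_e1 lam), leftMul_gen_pow_tmul (rho2 lam) Gen.xm
    (rho2_xm_e1 lam) (rho2_xm_xm_e1 lam) (map_zero _)]
  rw [TensorProduct.zero_tmul, add_zero, add_sub_right_comm, ← TensorProduct.tmul_sub, smul_add,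
    ← TensorProduct.tmul_smul, TensorProduct.smul_tmul', smul_smul, inv_mul_cancel₀ hlam, one_smul]
  simp only [mul_assoc, TensorProduct.tmul_smul]

/-- The basis vector `e₊` of `ℂ³`. -/
abbrev ePlus : Fin 3 → ℂ := ![1, 0, 0]

/-- The basis vector `e₋` of `ℂ³`. -/
abbrev eMinus : Fin 3 → ℂ := ![0, 0, 1]

theorem rho3_xp_e0 (lam : ℂ) : rho3 lam (gen lam Gen.xp) e0 = (2 * lam) • ePlus := by
  rw [rho3, AlgHom.comp_apply, lift_gen]
  ext i
  fin_cases i <;> simp [e0, mul_comm]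

theorem rho3_xp_ePlus (lam : ℂ) : rho3 lam (gen lam Gen.xp) ((2 * lam) • ePlus) = 0 := by
  rw [rho3, AlgHom.comp_apply, lift_gen]
  ext i
  fin_cases i <;> simp

theorem rho3_h_e0 (lam : ℂ) : rho3 lam (gen lam Gen.h) e0 = (0 : ℂ) • e0 := by
  rw [rho3, AlgHom.comp_apply, lift_gen]
  ext i
  fin_cases i <;> simp [e0]

theorem rho3_h_ePlus (lam : ℂ) : rho3 lam (gen lam Gen.h) ePlus = (2 * lam) • ePlus := by
  rw [rho3, AlgHom.comp_apply, lift_gen]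
  ext i
  fin_cases i <;> simp [mul_comm]

theorem rho3_xm_ePlus (lam : ℂ) : rho3 lam (gen lam Gen.xm) ePlus = lam • e0 := by
  rw [rho3, AlgHom.comp_apply, lift_gen]
  ext i
  fin_cases i <;> simp [e0]

theorem rho3_xm_e0 (lam : ℂ) : rho3 lam (gen lam Gen.xm) e0 = (2 * lam) • eMinus := by
  rw [rho3, AlgHom.comp_apply, lift_gen]
  ext i
  fin_cases i <;> simp [e0, mul_comm]

theorem rho3_xm_eMinus (lam : ℂ) : rho3 lam (gen lam Gen.xm) eMinus = 0 := by
  rw [rho3, AlgHom.comp_apply, lift_gen]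
  ext i
  fin_cases i <;> simp

theorem d0_rho3 {lam : ℂ} (hlam : lam ≠ 0) (f : R3 lam) :
    d0 (rho3 lam) e0 f = ePlus ⊗ₜ ((2 : ℂ) • derivXp lam (shift lam (2 * lam) f)) +
      e0 ⊗ₜ ((2 * lam) • derivXm lam (derivXp lam (shift lam (2 * lam) f))) +
      eMinus ⊗ₜ ((2 : ℂ) • derivXm lam f + (2 * lam ^ 2) •
        derivXm lam (derivXm lam (derivXp lam (shift lam (2 * lam) f)))) := by
  obtain ⟨m, rfl⟩ := pbw_surjective f
  suffices h : d0 (rho3 lam) e0 ∘ₗ (pbw lam).toLinearMap =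
      (TensorProduct.mk ℂ _ _ ePlus ∘ₗ ((2 : ℂ) • (derivXp lam ∘ₗ shift lam (2 * lam))) +
        TensorProduct.mk ℂ _ _ e0 ∘ₗ
          ((2 * lam) • (derivXm lam ∘ₗ derivXp lam ∘ₗ shift lam (2 * lam))) +
        TensorProduct.mk ℂ _ _ eMinus ∘ₗ ((2 : ℂ) • derivXm lam + (2 * lam ^ 2) •
          (derivXm lam ∘ₗ derivXm lam ∘ₗ derivXp lam ∘ₗ shift lam (2 * lam)))) ∘ₗ
        (pbw lam).toLinearMap from LinearMap.congr_fun h m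
  refine Finsupp.lhom_ext fun ⟨a, c⟩ p => ?_
  simp only [LinearMap.comp_apply, LinearMap.add_apply, LinearMap.smul_apply,
    LinearEquiv.coe_coe, TensorProduct.mk_apply,
    shift_pbw, derivXm_pbw, derivXp_pbw, shiftN_single, derivXmN_single, derivXpN_single,
    map_smul, d0_eq]
  simp only [pbw_single, map_mul, Module.End.mul_apply]
  -- x₊ splits e₀ into an e₀ part of weight 0 and an e₊ part of weight 2λ; only the latter is
  -- translated by `p(h)`. Then x₋ lowers e₊ to e₀ and e₀ to e₋.
  rw [leftMul_gen_pow_tmul (rho3 lam) Gen.xp (rho3_xp_e0 lam) (rho3_xp_ePlus lam) (map_zero _)]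
  simp only [TensorProduct.zero_tmul, add_zero, mul_one, map_add, ← TensorProduct.smul_tmul',
    map_smul]
  rw [leftMul_aeval_h_tmul (rho3 lam) (rho3_h_e0 lam),
    leftMul_aeval_h_tmul (rho3 lam) (rho3_h_ePlus lam), taylor_zero,
    leftMul_gen_pow_tmul (rho3 lam) Gen.xm (rho3_xm_e0 lam)
      (by rw [map_smul, rho3_xm_eMinus, smul_zero]) (map_zero _),
    leftMul_gen_pow_tmul (rho3 lam) Gen.xm (rho3_xm_ePlus lam)
      (by rw [map_smul, rho3_xm_e0]) (by rw [map_smul, map_smul, rho3_xm_eMinus, smul_zero,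
        smul_zero])]
  simp only [TensorProduct.zero_tmul, ← TensorProduct.smul_tmul', TensorProduct.tmul_smul,
    TensorProduct.tmul_add, mul_smul_comm, mul_assoc]
  -- Matches the factor a(a − 1) from ∂₋² with the quadratic binomial coefficient.
  have hc : (a : ℂ) * ((a - 1 : ℕ) : ℂ) = 2 * (a.choose 2 : ℂ) := by
    rw [Nat.cast_choose_two]
    cases a with
    | zero => simp
    | succ a =>
      push_cast [Nat.add_sub_cancel]
      ring
  rw [show a - 1 - 1 = a - 2 by omega]
  match_scalars
  · ring
  · field_simp
  · field_simp
  · field_simp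
  · field_simp
    linear_combination -(c : ℂ) * hc

/-! ### Coordinates on forms -/

section Forms

variable {lam : ℂ} {V : Type*} [AddCommGroup V] [Module ℂ V]

/-- The coefficient of a form with respect to a functional on the exterior power. -/
def coeff {n : ℕ} (c : Module.Dual ℂ (⋀[ℂ]^n V)) : Form lam V n →ₗ[ℂ] R3 lam :=
  TensorProduct.lid ℂ (R3 lam) ∘ₗ LinearMap.rTensor (R3 lam) c

theorem coeff_tmul {n : ℕ} (c : Module.Dual ℂ (⋀[ℂ]^n V)) (w : ⋀[ℂ]^n V) (f : R3 lam) :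
    coeff c (w ⊗ₜ[ℂ] f : Form lam V n) = c w • f := by
  simp [coeff]

/-- A family with a dual family is independent, and the binomial count `hk` makes it a basis of the
exterior power. Forms can then be compared coefficientwise. -/
theorem form_eq_sum [Module.Finite ℂ V] {n k : ℕ} (w : Fin k → ⋀[ℂ]^n V)
    (c : Fin k → Module.Dual ℂ (⋀[ℂ]^n V)) (h : ∀ i j, c i (w j) = if i = j then 1 else 0)
    (hk : k = (Module.finrank ℂ V).choose n) (ω : Form lam V n) :
    ω = ∑ i, w i ⊗ₜ[ℂ] coeff (c i) ω := by
  have hli : LinearIndependent ℂ w := LinearIndependent.of_pairwise_dual_eq_zero_one w c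
    (fun i j hij => by simp [h, hij]) (fun i => by simp [h])
  have hw (x : ⋀[ℂ]^n V) : x = ∑ i, c i x • w i := by
    have hx : x ∈ Submodule.span ℂ (Set.range w) := by
      rw [hli.span_eq_top_of_card_eq_finrank' (by rw [exteriorPower.finrank_eq, ← hk,
        Fintype.card_fin])]
      trivial
    induction hx using Submodule.span_induction with
    | mem x hx =>
      obtain ⟨j, rfl⟩ := hx
      simp [h]
    | zero => simp
    | add x y _ _ hx hy =>
      conv_lhs => rw [hx, hy]
      simp [add_smul, Finset.sum_add_distrib]
    | smul a x _ hx =>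
      conv_lhs => rw [hx]
      simp [Finset.smul_sum, smul_smul]
  induction ω using TensorProduct.induction_on with
  | zero => simp
  | add x y hx hy =>
    conv_lhs => rw [hx, hy]
    simp [TensorProduct.tmul_add, Finset.sum_add_distrib]
  | tmul x f =>
    conv_lhs => rw [hw x]
    simp [coeff_tmul, TensorProduct.sum_tmul, TensorProduct.smul_tmul]

/-- The map `v f ↦ (w ∧ v) f`. -/
def wedgeForm {n : ℕ} (w : ⋀[ℂ]^n V) : V ⊗[ℂ] R3 lam →ₗ[ℂ] Form lam V (n + 1) :=
  LinearMap.rTensor (R3 lam) (wedge V n) ∘ₗ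
    (TensorProduct.assoc ℂ (⋀[ℂ]^n V) V (R3 lam)).symm.toLinearMap ∘ₗ TensorProduct.mk ℂ _ _ w

theorem wedgeForm_tmul {n : ℕ} (w : ⋀[ℂ]^n V) (v : V) (f : R3 lam) :
    wedgeForm w (v ⊗ₜ f) = wedge V n (w ⊗ₜ v) ⊗ₜ f := rfl

theorem d_tmul (ρ : R3 lam →ₐ[ℂ] Module.End ℂ V) (L : V) (n : ℕ) (w : ⋀[ℂ]^n V) (f : R3 lam) :
    d ρ L n (w ⊗ₜ f) = wedgeForm w (d0 ρ L f) := rfl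

open exteriorPower

theorem wedge_zero (v : V) : wedge V 0 ((zeroEquiv ℂ V).symm 1 ⊗ₜ v) = ιMulti ℂ 1 ![v] := by
  have h : (zeroEquiv ℂ V).symm 1 = ιMulti ℂ 0 ![] := by
    rw [LinearEquiv.symm_apply_eq, zeroEquiv_ιMulti]
  refine Subtype.ext ?_
  rw [wedge_tmul, h]
  simp [ExteriorAlgebra.ιMulti_apply]

theorem wedge_one (v w : V) : wedge V 1 (ιMulti ℂ 1 ![v] ⊗ₜ w) = ιMulti ℂ 2 ![v, w] := by
  refine Subtype.ext ?_
  rw [wedge_tmul]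
  simp [ExteriorAlgebra.ιMulti_apply]

theorem wedge_two (u v w : V) :
    wedge V 2 (ιMulti ℂ 2 ![u, v] ⊗ₜ w) = ιMulti ℂ 3 ![u, v, w] := by
  refine Subtype.ext ?_
  rw [wedge_tmul]
  simp [ExteriorAlgebra.ιMulti_apply, mul_assoc]

theorem oneForm_eq (v : V) (f : R3 lam) : oneForm v f = ιMulti ℂ 1 ![v] ⊗ₜ f := by
  rw [oneForm, oneEquiv_symm_apply]
  congr 2
  ext i
  simp

theorem eq_ofFun (ω : Form lam V 0) : ∃ f, ω = ofFun V f := by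
  induction ω using TensorProduct.induction_on with
  | zero => exact ⟨0, by simp [ofFun]⟩
  | add x y hx hy =>
    obtain ⟨f, rfl⟩ := hx
    obtain ⟨g, rfl⟩ := hy
    exact ⟨f + g, by simp [ofFun, TensorProduct.tmul_add]⟩
  | tmul w f =>
    refine ⟨zeroEquiv ℂ V w • f, ?_⟩
    rw [ofFun, ← TensorProduct.smul_tmul, ← map_smul, smul_eq_mul, mul_one,
      LinearEquiv.symm_apply_apply]

theorem ofFun_injective {f : R3 lam} (hf : ofFun V f = 0) : f = 0 := by
  have h := congrArg (coeff (zeroEquiv ℂ V).toLinearMap) hf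
  rw [ofFun, coeff_tmul, map_zero] at h
  simpa using h

/-! ### Criteria for the computation of the cohomology -/

theorem subsingleton_H {ρ : R3 lam →ₐ[ℂ] Module.End ℂ V} {L : V} {n : ℕ}
    (h : ∀ ω ∈ cocycles ρ L n, ω ∈ coboundaries ρ L n) : Subsingleton (H ρ L n) := by
  rw [Submodule.Quotient.subsingleton_iff, eq_top_iff]
  exact fun ω _ => h ω.1 ω.2

theorem exists_equiv_H {ρ : R3 lam →ₐ[ℂ] Module.End ℂ V} {L : V} {n : ℕ}
    (φ : ℂ[X] →ₗ[ℂ] Form lam V n) (hφ : ∀ p, φ p ∈ cocycles ρ L n)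
    (hinj : ∀ p, φ p ∈ coboundaries ρ L n → p = 0)
    (hsurj : ∀ ω ∈ cocycles ρ L n, ∃ p, ω - φ p ∈ coboundaries ρ L n) :
    ∃ e : ℂ[X] ≃ₗ[ℂ] H ρ L n, ∀ p, ∃ hp : φ p ∈ cocycles ρ L n, e p = H.mk ρ L n (φ p) hp := by
  let ψ : ℂ[X] →ₗ[ℂ] H ρ L n :=
    ((coboundaries ρ L n).submoduleOf (cocycles ρ L n)).mkQ ∘ₗ φ.codRestrict _ hφ
  refine ⟨LinearEquiv.ofBijective ψ ⟨?_, ?_⟩, fun p => ⟨hφ p, rfl⟩⟩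
  · refine (injective_iff_map_eq_zero ψ).2 fun p hp => hinj p ?_
    exact (Submodule.Quotient.mk_eq_zero ((coboundaries ρ L n).submoduleOf _)).1 hp
  · intro x
    obtain ⟨⟨ω, hω⟩, rfl⟩ := Submodule.Quotient.mk_surjective _ x
    obtain ⟨p, hp⟩ := hsurj ω hω
    refine ⟨p, ((Submodule.Quotient.eq _).2 ?_).symm⟩
    exact hp

end Forms

open exteriorPower

/-! ### Coordinates in dimensions two and three -/

/-- The minor of index `s` as a functional on an exterior power of `ℂᵐ`. -/
def minor {m n : ℕ} (s : Fin n → Fin m) : Module.Dual ℂ (⋀[ℂ]^n (Fin m → ℂ)) :=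
  pairingDual ℂ _ n (ιMulti ℂ n fun i => LinearMap.proj (s i))

theorem minor_ιMulti {m n : ℕ} (s : Fin n → Fin m) (v : Fin n → Fin m → ℂ) :
    minor s (ιMulti ℂ n v) = Matrix.det (.of fun i j => v i (s j)) := by
  simp [minor]

/-- The second basis vector of `ℂ²`. -/
abbrev e2 : Fin 2 → ℂ := ![0, 1]

theorem oneForm_eq_two {lam : ℂ} (ω : Form lam (Fin 2 → ℂ) 1) :
    ω = oneForm e1 (coeff (minor ![0]) ω) + oneForm e2 (coeff (minor ![1]) ω) := by
  conv_lhs => rw [form_eq_sum ![ιMulti ℂ 1 ![e1], ιMulti ℂ 1 ![e2]] ![minor ![0], minor ![1]]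
    (fun i j => by fin_cases i <;> fin_cases j <;> simp [minor_ιMulti, e1]) (by simp) ω]
  simp [Fin.sum_univ_two, oneForm_eq]

theorem twoForm_eq_two {lam : ℂ} (ω : Form lam (Fin 2 → ℂ) 2) :
    ω = ιMulti ℂ 2 ![e1, e2] ⊗ₜ coeff (minor ![0, 1]) ω := by
  conv_lhs => rw [form_eq_sum (fun _ : Fin 1 => ιMulti ℂ 2 ![e1, e2]) (fun _ => minor ![0, 1])
    (fun i j => by fin_cases i; fin_cases j; simp [minor_ιMulti, e1, Matrix.det_fin_two])
    (by simp) ω]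
  simp

theorem oneForm_eq_three {lam : ℂ} (ω : Form lam (Fin 3 → ℂ) 1) :
    ω = oneForm ePlus (coeff (minor ![0]) ω) + oneForm e0 (coeff (minor ![1]) ω) +
      oneForm eMinus (coeff (minor ![2]) ω) := by
  conv_lhs => rw [form_eq_sum ![ιMulti ℂ 1 ![ePlus], ιMulti ℂ 1 ![e0], ιMulti ℂ 1 ![eMinus]]
    ![minor ![0], minor ![1], minor ![2]]
    (fun i j => by fin_cases i <;> fin_cases j <;> simp [minor_ιMulti, e0]) (by simp) ω]
  simp [Fin.sum_univ_three, oneForm_eq]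

theorem twoForm_eq_three {lam : ℂ} (ω : Form lam (Fin 3 → ℂ) 2) :
    ω = ιMulti ℂ 2 ![ePlus, e0] ⊗ₜ coeff (minor ![0, 1]) ω +
      ιMulti ℂ 2 ![ePlus, eMinus] ⊗ₜ coeff (minor ![0, 2]) ω +
      ιMulti ℂ 2 ![e0, eMinus] ⊗ₜ coeff (minor ![1, 2]) ω := by
  conv_lhs => rw [form_eq_sum
    ![ιMulti ℂ 2 ![ePlus, e0], ιMulti ℂ 2 ![ePlus, eMinus], ιMulti ℂ 2 ![e0, eMinus]]
    ![minor ![0, 1], minor ![0, 2], minor ![1, 2]]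
    (fun i j => by
      fin_cases i <;> fin_cases j <;> simp [minor_ιMulti, e0, Matrix.det_fin_two])
    (by simp) ω]
  simp [Fin.sum_univ_three]

theorem threeForm_eq_three {lam : ℂ} (ω : Form lam (Fin 3 → ℂ) 3) :
    ω = ιMulti ℂ 3 ![ePlus, e0, eMinus] ⊗ₜ coeff (minor ![0, 1, 2]) ω := by
  conv_lhs => rw [form_eq_sum (fun _ : Fin 1 => ιMulti ℂ 3 ![ePlus, e0, eMinus])
    (fun _ => minor ![0, 1, 2])
    (fun i j => by fin_cases i; fin_cases j; simp [minor_ιMulti, e0, Matrix.det_fin_three])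
    (by simp) ω]
  simp

/-! ### The two-dimensional calculus -/

section Two

variable {lam : ℂ}

theorem d_zero_two (hlam : lam ≠ 0) (f : R3 lam) : d (rho2 lam) e1 0 (ofFun _ f) =
    oneForm e1 (lam⁻¹ • (shift lam lam f - f)) +
      oneForm e2 (derivXm lam (shift lam lam f)) := by
  simp only [ofFun, d_tmul, d0_rho2 hlam, oneForm_eq, map_add, wedgeForm_tmul, wedge_zero]

theorem d_one_two (hlam : lam ≠ 0) (v : Fin 2 → ℂ) (f : R3 lam) :
    d (rho2 lam) e1 1 (oneForm v f) =
    ιMulti ℂ 2 ![v, e1] ⊗ₜ (lam⁻¹ • (shift lam lam f - f)) +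
      ιMulti ℂ 2 ![v, e2] ⊗ₜ (derivXm lam (shift lam lam f)) := by
  simp only [oneForm_eq, d_tmul, d0_rho2 hlam, map_add, wedgeForm_tmul, wedge_one]

theorem mem_cocycles_zero_two (hlam : lam ≠ 0) (f : R3 lam) :
    ofFun _ f ∈ cocycles (rho2 lam) e1 0 ↔ shift lam lam f = f ∧ derivXm lam f = 0 := by
  rw [cocycles, LinearMap.mem_ker, d_zero_two hlam]
  constructor
  · intro h
    have h0 := congrArg (coeff (minor ![0])) h
    have h1 := congrArg (coeff (minor ![1])) h
    simp [oneForm_eq, coeff_tmul, minor_ιMulti, e1, hlam, sub_eq_zero] at h0 h1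
    rw [h0] at h1
    exact ⟨h0, h1⟩
  · rintro ⟨h0, h1⟩
    simp [h0, h1, oneForm]

theorem exists_equiv_H_zero_two (hlam : lam ≠ 0) :
    ∃ e : ℂ[X] ≃ₗ[ℂ] H (rho2 lam) e1 0, ∀ p : ℂ[X],
      ∃ hp : ofFun (Fin 2 → ℂ) (aeval (gen lam Gen.xp) p) ∈ cocycles (rho2 lam) e1 0,
        e p = H.mk (rho2 lam) e1 0 (ofFun (Fin 2 → ℂ) (aeval (gen lam Gen.xp) p)) hp := by
  refine exists_equiv_H (TensorProduct.mk ℂ _ _ ((zeroEquiv ℂ (Fin 2 → ℂ)).symm 1) ∘ₗ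
    (aeval (gen lam Gen.xp)).toLinearMap) (fun p => ?_) (fun p hp => ?_) (fun ω hω => ?_)
  · exact (mem_cocycles_zero_two hlam _).2 ⟨shift_aeval_xp lam hlam p, derivXm_aeval_xp lam p⟩
  · exact aeval_xp_injective (ofFun_injective ((Submodule.mem_bot ℂ).1 hp))
  · obtain ⟨f, rfl⟩ := eq_ofFun ω
    rw [mem_cocycles_zero_two hlam] at hω
    obtain ⟨p, rfl⟩ := exists_aeval_xp hlam hω.1 hω.2
    exact ⟨p, (Submodule.mem_bot ℂ).2 (sub_self _)⟩

theorem subsingleton_H_one_two (hlam : lam ≠ 0) : Subsingleton (H (rho2 lam) e1 1) := by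
  refine subsingleton_H fun ω hω => ?_
  -- Makes the e₁ component of d g equal to that of ω.
  obtain ⟨g, hg⟩ := shift_sub_surjective lam hlam (lam • coeff (minor ![0]) ω)
  have hη : ω - d (rho2 lam) e1 0 (ofFun _ g) ∈ cocycles (rho2 lam) e1 1 :=
    sub_mem hω (coboundaries_le_cocycles _ _ 1 ⟨_, rfl⟩)
  obtain ⟨k, hk⟩ : ∃ k, ω - d (rho2 lam) e1 0 (ofFun _ g) = oneForm e2 k := by
    refine ⟨coeff (minor ![1]) ω - derivXm lam (shift lam lam g), ?_⟩
    rw [d_zero_two hlam, hg, smul_smul, inv_mul_cancel₀ hlam, one_smul]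
    conv_lhs => enter [1]; rw [oneForm_eq_two ω]
    rw [add_sub_add_left_eq_sub, oneForm_eq, oneForm_eq, oneForm_eq, TensorProduct.tmul_sub]
  rw [hk, cocycles, LinearMap.mem_ker, d_one_two hlam] at hη
  have hk' : shift lam lam k = k := by
    have h := congrArg (coeff (minor ![0, 1])) hη
    refine Eq.symm ?_
    simpa [coeff_tmul, minor_ιMulti, e1, Matrix.det_fin_two, hlam, sub_eq_zero] using h
  -- For translation-invariant u the e₁ component of d u vanishes, so d u = e₂ ∂₋u.
  obtain ⟨u, hu, rfl⟩ := derivXm_surjective_on_shift_eq lam hlam k hk'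
  refine ⟨ofFun _ g + ofFun _ u, ?_⟩
  rw [map_add, ← eq_sub_iff_add_eq', hk, d_zero_two hlam u, hu]
  simp [oneForm]

theorem subsingleton_H_two_two (hlam : lam ≠ 0) : Subsingleton (H (rho2 lam) e1 2) := by
  refine subsingleton_H fun ω _ => ?_
  -- The sign comes from e₂ ∧ e₁ = −e₁ ∧ e₂.
  obtain ⟨g, hg⟩ := shift_sub_surjective lam hlam (-(lam • coeff (minor ![0, 1]) ω))
  refine ⟨oneForm e2 g, ?_⟩
  rw [twoForm_eq_two (d _ _ _ _), d_one_two hlam, hg]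
  conv_rhs => rw [twoForm_eq_two ω]
  simp [coeff_tmul, minor_ιMulti, e1, Matrix.det_fin_two, smul_smul, hlam]

end Two

/-! ### The three-dimensional calculus -/

section Three

variable {lam : ℂ}

theorem d_zero_three (hlam : lam ≠ 0) (f : R3 lam) : d (rho3 lam) e0 0 (ofFun _ f) =
    oneForm ePlus ((2 : ℂ) • derivXp lam (shift lam (2 * lam) f)) +
      oneForm e0 ((2 * lam) • derivXm lam (derivXp lam (shift lam (2 * lam) f))) +
      oneForm eMinus ((2 : ℂ) • derivXm lam f + (2 * lam ^ 2) •
        derivXm lam (derivXm lam (derivXp lam (shift lam (2 * lam) f)))) := by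
  simp only [ofFun, d_tmul, d0_rho3 hlam, oneForm_eq, map_add, wedgeForm_tmul, wedge_zero]

theorem d_one_three (hlam : lam ≠ 0) (v : Fin 3 → ℂ) (f : R3 lam) :
    d (rho3 lam) e0 1 (oneForm v f) =
    ιMulti ℂ 2 ![v, ePlus] ⊗ₜ ((2 : ℂ) • derivXp lam (shift lam (2 * lam) f)) +
      ιMulti ℂ 2 ![v, e0] ⊗ₜ
        ((2 * lam) • derivXm lam (derivXp lam (shift lam (2 * lam) f))) +
      ιMulti ℂ 2 ![v, eMinus] ⊗ₜ ((2 : ℂ) • derivXm lam f + (2 * lam ^ 2) •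
        derivXm lam (derivXm lam (derivXp lam (shift lam (2 * lam) f)))) := by
  simp only [oneForm_eq, d_tmul, d0_rho3 hlam, map_add, wedgeForm_tmul, wedge_one]

theorem d_two_three (hlam : lam ≠ 0) (v w : Fin 3 → ℂ) (f : R3 lam) :
    d (rho3 lam) e0 2 (ιMulti ℂ 2 ![v, w] ⊗ₜ f) =
    ιMulti ℂ 3 ![v, w, ePlus] ⊗ₜ ((2 : ℂ) • derivXp lam (shift lam (2 * lam) f)) +
      ιMulti ℂ 3 ![v, w, e0] ⊗ₜ
        ((2 * lam) • derivXm lam (derivXp lam (shift lam (2 * lam) f))) +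
      ιMulti ℂ 3 ![v, w, eMinus] ⊗ₜ ((2 : ℂ) • derivXm lam f + (2 * lam ^ 2) •
        derivXm lam (derivXm lam (derivXp lam (shift lam (2 * lam) f)))) := by
  simp only [d_tmul, d0_rho3 hlam, map_add, wedgeForm_tmul, wedge_two]

theorem mem_cocycles_zero_three (hlam : lam ≠ 0) (f : R3 lam) :
    ofFun _ f ∈ cocycles (rho3 lam) e0 0 ↔
      derivXp lam (shift lam (2 * lam) f) = 0 ∧ derivXm lam f = 0 := by
  rw [cocycles, LinearMap.mem_ker, d_zero_three hlam]
  constructor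
  · intro h
    have h0 := congrArg (coeff (minor ![0])) h
    have h1 := congrArg (coeff (minor ![2])) h
    simp [oneForm_eq, coeff_tmul, minor_ιMulti, e0] at h0 h1
    simp [h0] at h1
    exact ⟨h0, h1⟩
  · rintro ⟨h0, h1⟩
    simp [h0, h1, oneForm]

theorem exists_equiv_H_zero_three (hlam : lam ≠ 0) :
    ∃ e : ℂ[X] ≃ₗ[ℂ] H (rho3 lam) e0 0, ∀ p : ℂ[X],
      ∃ hp : ofFun (Fin 3 → ℂ) (aeval (gen lam Gen.h) p) ∈ cocycles (rho3 lam) e0 0,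
        e p = H.mk (rho3 lam) e0 0 (ofFun (Fin 3 → ℂ) (aeval (gen lam Gen.h) p)) hp := by
  refine exists_equiv_H (TensorProduct.mk ℂ _ _ ((zeroEquiv ℂ (Fin 3 → ℂ)).symm 1) ∘ₗ
    (aeval (gen lam Gen.h)).toLinearMap) (fun p => ?_) (fun p hp => ?_) (fun ω hω => ?_)
  · exact (mem_cocycles_zero_three hlam _).2
      ⟨derivXp_shift_aeval_h lam _ p, derivXm_aeval_h lam p⟩
  · exact aeval_h_injective (ofFun_injective ((Submodule.mem_bot ℂ).1 hp))
  · obtain ⟨f, rfl⟩ := eq_ofFun ω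
    rw [mem_cocycles_zero_three hlam] at hω
    obtain ⟨p, rfl⟩ := exists_aeval_h hω.1 hω.2
    exact ⟨p, (Submodule.mem_bot ℂ).2 (sub_self _)⟩

theorem exists_equiv_H_one_three (hlam : lam ≠ 0) :
    ∃ e : ℂ[X] ≃ₗ[ℂ] H (rho3 lam) e0 1, ∀ p : ℂ[X],
      ∃ hp : oneForm e0 (aeval (gen lam Gen.h) p) ∈ cocycles (rho3 lam) e0 1,
        e p = H.mk (rho3 lam) e0 1 (oneForm e0 (aeval (gen lam Gen.h) p)) hp := by
  refine exists_equiv_H (TensorProduct.mk ℂ _ _ ((oneEquiv ℂ (Fin 3 → ℂ)).symm e0) ∘ₗ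
    (aeval (gen lam Gen.h)).toLinearMap) (fun p => ?_) (fun p hp => ?_) (fun ω hω => ?_)
  · change oneForm e0 (aeval (gen lam Gen.h) p) ∈ _
    rw [cocycles, LinearMap.mem_ker, d_one_three hlam, derivXp_shift_aeval_h, derivXm_aeval_h]
    simp
  · obtain ⟨η, hη⟩ : oneForm e0 (aeval (gen lam Gen.h) p) ∈ coboundaries (rho3 lam) e0 1 := hp
    obtain ⟨g, rfl⟩ := eq_ofFun η
    rw [d_zero_three hlam] at hη
    have h0 := congrArg (coeff (minor ![0])) hη
    have h1 := congrArg (coeff (minor ![1])) hη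
    simp [oneForm_eq, coeff_tmul, minor_ιMulti, e0] at h0 h1
    -- The e₀ component of d g is λ∂₋ applied to its e₊ component, which is zero here. So a nonzero
    -- e₀ `p(h)` is never exact.
    rw [h0, map_zero, smul_zero] at h1
    exact aeval_h_injective h1.symm
  -- Subtracting d g clears the e₊ component of ω.
  · obtain ⟨g, hg⟩ := shift_derivXp_surjective lam (2 * lam) ((2 : ℂ)⁻¹ • coeff (minor ![0]) ω)
    have hη : ω - d (rho3 lam) e0 0 (ofFun _ g) ∈ cocycles (rho3 lam) e0 1 :=
      sub_mem hω (coboundaries_le_cocycles _ _ 1 ⟨_, rfl⟩)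
    obtain ⟨j, k, hjk⟩ : ∃ j k, ω - d (rho3 lam) e0 0 (ofFun _ g) =
        oneForm e0 j + oneForm eMinus k := by
      refine ⟨coeff (minor ![1]) (ω - d (rho3 lam) e0 0 (ofFun _ g)),
        coeff (minor ![2]) (ω - d (rho3 lam) e0 0 (ofFun _ g)), ?_⟩
      conv_lhs => rw [oneForm_eq_three (ω - d (rho3 lam) e0 0 (ofFun _ g))]
      have h : coeff (minor ![0]) (ω - d (rho3 lam) e0 0 (ofFun _ g)) = 0 := by
        rw [d_zero_three hlam, hg]
        simp [oneForm_eq, coeff_tmul, minor_ιMulti, e0]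
      rw [h, add_assoc, add_eq_right]
      simp [oneForm]
    have hk : derivXp lam (shift lam (2 * lam) k) = 0 := by
      rw [hjk, cocycles, LinearMap.mem_ker, map_add, d_one_three hlam, d_one_three hlam] at hη
      -- Only e₋ k contributes to e₊ ∧ e₋.
      have h := congrArg (coeff (minor ![0, 2])) hη
      simpa [coeff_tmul, minor_ιMulti, e0, Matrix.det_fin_two] using h
    -- On the kernel of ∂₊ T_{2λ} one has d u = 2 e₋ ∂₋u, hence the factor 1/2.
    obtain ⟨u, hu, hu'⟩ := derivXm_surjective_on_ker lam (2 * lam) ((2 : ℂ)⁻¹ • k)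
      (by rw [map_smul, map_smul, hk, smul_zero])
    have hdu : d (rho3 lam) e0 0 (ofFun _ u) = oneForm eMinus k := by
      rw [d_zero_three hlam, hu, hu']
      simp [oneForm]
    have hj : oneForm e0 j ∈ cocycles (rho3 lam) e0 1 := by
      have h := sub_mem hη (coboundaries_le_cocycles (rho3 lam) e0 1 ⟨ofFun _ u, rfl⟩)
      rwa [hjk, hdu, add_sub_cancel_right] at h
    obtain ⟨p, rfl⟩ : ∃ p : ℂ[X], aeval (gen lam Gen.h) p = j := by
      rw [cocycles, LinearMap.mem_ker, d_one_three hlam] at hj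
      have h0 := congrArg (coeff (minor ![0, 1])) hj
      have h1 := congrArg (coeff (minor ![1, 2])) hj
      simp [coeff_tmul, minor_ιMulti, e0, Matrix.det_fin_two] at h0 h1
      simp [h0] at h1
      exact exists_aeval_h h0 h1
    refine ⟨p, ofFun _ g + ofFun _ u, ?_⟩
    rw [map_add, hdu, eq_sub_iff_add_eq, sub_eq_iff_eq_add'.1 hjk, add_assoc,
      add_comm (oneForm e0 _)]
    rfl

theorem subsingleton_H_two_three (hlam : lam ≠ 0) : Subsingleton (H (rho3 lam) e0 2) := by
  refine subsingleton_H fun ω hω => ?_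
  -- In d(e₀ g + e₋ k) the coefficients of e₊ ∧ e₀ and e₊ ∧ e₋ are −2 ∂₊T_{2λ} g and −2 ∂₊T_{2λ} k,
  -- so they can be prescribed independently.
  obtain ⟨g, hg⟩ := shift_derivXp_surjective lam (2 * lam)
    (-(2 : ℂ)⁻¹ • coeff (minor ![0, 1]) ω)
  obtain ⟨k, hk⟩ := shift_derivXp_surjective lam (2 * lam)
    (-(2 : ℂ)⁻¹ • coeff (minor ![0, 2]) ω)
  set η := ω - d (rho3 lam) e0 1 (oneForm e0 g + oneForm eMinus k) with hη
  have hηc : η ∈ cocycles (rho3 lam) e0 2 :=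
    sub_mem hω (coboundaries_le_cocycles _ _ 2 ⟨_, rfl⟩)
  obtain ⟨j, hj⟩ : ∃ j, η = ιMulti ℂ 2 ![e0, eMinus] ⊗ₜ j := by
    refine ⟨coeff (minor ![1, 2]) η, ?_⟩
    have h0 : coeff (minor ![0, 1]) η = 0 := by
      rw [hη, map_add, d_one_three hlam, d_one_three hlam, hg, hk]
      simp [coeff_tmul, minor_ιMulti, e0, Matrix.det_fin_two]
    have h1 : coeff (minor ![0, 2]) η = 0 := by
      rw [hη, map_add, d_one_three hlam, d_one_three hlam, hg, hk]
      simp [coeff_tmul, minor_ιMulti, e0, Matrix.det_fin_two]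
    conv_lhs => rw [twoForm_eq_three η, h0, h1]
    simp
  have hj' : derivXp lam (shift lam (2 * lam) j) = 0 := by
    rw [hj, cocycles, LinearMap.mem_ker, d_two_three hlam] at hηc
    have h := congrArg (coeff (minor ![0, 1, 2])) hηc
    simpa [coeff_tmul, minor_ιMulti, e0, Matrix.det_fin_three] using h
  -- With u in the kernel of ∂₊ T_{2λ}, d(e₀ u) = (e₀ ∧ e₋) 2∂₋u.
  obtain ⟨u, hu, hu'⟩ := derivXm_surjective_on_ker lam (2 * lam) ((2 : ℂ)⁻¹ • j)
    (by rw [map_smul, map_smul, hj', smul_zero])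
  refine ⟨oneForm e0 g + oneForm eMinus k + oneForm e0 u, ?_⟩
  rw [map_add, ← eq_sub_iff_add_eq', ← hη, hj, d_one_three hlam, hu, hu']
  simp

theorem subsingleton_H_three_three (hlam : lam ≠ 0) : Subsingleton (H (rho3 lam) e0 3) := by
  refine subsingleton_H fun ω _ => ?_
  -- Only the e₊ term of d g survives the product with e₀ ∧ e₋, and e₀ ∧ e₋ ∧ e₊ is an even
  -- permutation of e₊ ∧ e₀ ∧ e₋.
  obtain ⟨g, hg⟩ := shift_derivXp_surjective lam (2 * lam)
    ((2 : ℂ)⁻¹ • coeff (minor ![0, 1, 2]) ω)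
  refine ⟨ιMulti ℂ 2 ![e0, eMinus] ⊗ₜ g, ?_⟩
  rw [threeForm_eq_three (d _ _ _ _), d_two_three hlam, hg]
  conv_rhs => rw [threeForm_eq_three ω]
  simp [coeff_tmul, minor_ιMulti, e0, Matrix.det_fin_three]

end Three

end R3Calculus

end

open R3Calculus Polynomial in
theorem mainTheorem6 (lam : ℂ) (hlam : lam ≠ 0) :
    -- the three-dimensional calculus
    ((∃ e : ℂ[X] ≃ₗ[ℂ] H (rho3 lam) e0 0, ∀ p : ℂ[X],
        ∃ hp : ofFun (Fin 3 → ℂ) (aeval (gen lam Gen.h) p) ∈ cocycles (rho3 lam) e0 0,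
          e p = H.mk (rho3 lam) e0 0 (ofFun (Fin 3 → ℂ) (aeval (gen lam Gen.h) p)) hp) ∧
      (∃ e : ℂ[X] ≃ₗ[ℂ] H (rho3 lam) e0 1, ∀ p : ℂ[X],
        ∃ hp : oneForm e0 (aeval (gen lam Gen.h) p) ∈ cocycles (rho3 lam) e0 1,
          e p = H.mk (rho3 lam) e0 1 (oneForm e0 (aeval (gen lam Gen.h) p)) hp) ∧
      Subsingleton (H (rho3 lam) e0 2) ∧ Subsingleton (H (rho3 lam) e0 3)) ∧
    -- the two-dimensional calculus
    ((∃ e : ℂ[X] ≃ₗ[ℂ] H (rho2 lam) e1 0, ∀ p : ℂ[X],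
        ∃ hp : ofFun (Fin 2 → ℂ) (aeval (gen lam Gen.xp) p) ∈ cocycles (rho2 lam) e1 0,
          e p = H.mk (rho2 lam) e1 0 (ofFun (Fin 2 → ℂ) (aeval (gen lam Gen.xp) p)) hp) ∧
      Subsingleton (H (rho2 lam) e1 1) ∧ Subsingleton (H (rho2 lam) e1 2)) :=
  ⟨⟨exists_equiv_H_zero_three hlam, exists_equiv_H_one_three hlam,
    subsingleton_H_two_three hlam, subsingleton_H_three_three hlam⟩,
    exists_equiv_H_zero_two hlam, subsingleton_H_one_two hlam, subsingleton_H_two_two hlam⟩
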